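/- **Setting.** Let $N,\tau\ge 1$, let $f_1,\dots,f_N:\mathbb R^m\to\mathbb R$, $f=\frac1N\sum_i f_i$, and let $W=[w_{ij}]\in\mathbb R^{N\times N}$ be symmetric, doubly stochastic, primitive and positive definite, with mixing rate $\lambda=\|W-\frac1N\mathbf 1\mathbf 1^{\mathsf T}\|<1$ and smallest eigenvalue $\underline\lambda>0$. Given $x_i^0\in\mathbb R^m$ and either $y_i^0=0$ for all $i$ or $y_i^0=x_i^0-\sum_j w_{ij}x_j^0$ for all $i$, Local Exact-Diffusion with stepsizes $\alpha>0$, $\beta=1/\tau$ computes, for $r=0,1,2,\dots$, $$\phi_{i,0}^r=x_i^r,\qquad \phi_{i,t+1}^r=\phi_{i,t}^r-\alpha\nabla F_i(\phi_{i,t}^r;\xi_{i,t}^r)-\beta y_i^r\quad(0\le t<\tau),$$ $$x_i^{r+1}=\sum_j w_{ij}\phi_{j,\tau}^r,\qquad y_i^{r+1}=y_i^r+\phi_{i,\tau}^r-x_i^{r+1}.$$ Here the random data $\xi_{i,t}^r$ ($r\ge0$, $0\le t<\tau$, $1\le i\le N$) are independent, and conditionally on all iterates of all nodes up to local step $t$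 of round $r$, the error $\nabla F_i(\phi_{i,t}^r;\xi_{i,t}^r)-\nabla f_i(\phi_{i,t}^r)$ has mean zero and second moment at most $\sigma^2$. Each $f_i$ is $L$-smooth ($L>0$) and $\mu$-strongly convex with $0\le\mu\le L$ (merely convex if $\mu=0$), and $x^\star$ is a minimizer of $f$. Write $\bar x^r=\frac1N\sum_i x_i^r$ and $\varsigma_0^2=\frac1N\sum_i\|\nabla f_i(\bar x^0)-\nabla f(\bar x^0)\|^2$. **Theorem.** There are absolute constants $c,C>0$ such that the following holds in this setting. * If $\mu=0$ and $\alpha\le c\,\frac{1-\lambda}{\tau L}$, then $f(\bar x^r)-f(x^\star)$ is integrable for every $r$, and for every $R\ge1$ $$\frac1R\sum_{r=0}^{R-1}\mathbb E[f(\bar x^r)-f(x^\star)]\le C\Big(\frac{\|\bar x^0-x^\star\|^2}{\alpha\tau R}+\frac{\alpha^2\tau^2L\,\varsigma_0^2}{(1-\lambda)^2R}+\frac{L\sum_i\|x_i^0-\bar x^0\|^2}{(1-\lambda)\,\underline\lambda\,N R}\Big)+C\Big(\frac{\alpha\sigma^2}{N}+\frac{\alpha^2\tau L\sigma^2}{1-\lambda}\Big).$$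 * If $\mu>0$ and $\alpha\le c\,\frac{\mu(1-\lambda)}{\tau L^2}$, then for every $r\ge0$ the variable $\|\bar x^r-x^\star\|^2$ is integrable and $$\mathbb E\|\bar x^r-x^\star\|^2\le\Big(1-\frac{\alpha\tau\mu}{4}\Big)^r a_0+C\Big(\frac{\alpha\sigma^2}{\mu N}+\frac{\alpha^2\tau L\sigma^2}{\mu(1-\lambda)}\Big),$$ where $a_0=\|\bar x^0-x^\star\|^2+C\Big(\frac{\alpha^2\tau^2\varsigma_0^2}{1-\lambda}+\frac{\sum_i\|x_i^0-\bar x^0\|^2}{\underline\lambda\,N}\Big)$. The terms with $\sum_i\|x_i^0-\bar x^0\|^2$ vanish when all nodes start from the same point. -/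

import Mathlib

open MeasureTheory ProbabilityTheory

universe u v

namespace LED

/-- The space `ℝ^m` with the Euclidean norm. -/
abbrev Vec (m : ℕ) : Type := EuclideanSpace ℝ (Fin m)

/-- The node average `(1/N) ∑ᵢ xᵢ`. -/
noncomputable def avg {N m : ℕ} (x : Fin N → Vec m) : Vec m :=
  (N : ℝ)⁻¹ • ∑ i, x i

/-- One diffusion (communication) step: `(W x)ᵢ = ∑ⱼ wᵢⱼ xⱼ`. -/
noncomputable def mix {N m : ℕ} (W : Matrix (Fin N) (Fin N) ℝ) (x : Fin N → Vec m) :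
    Fin N → Vec m :=
  fun i => ∑ j, W i j • x j

/-- The consensus error `∑ᵢ ‖xᵢ - x̄‖²`. -/
noncomputable def consensusError {N m : ℕ} (x : Fin N → Vec m) : ℝ :=
  ∑ i, ‖x i - avg x‖ ^ 2

/-- Symmetric, doubly stochastic, primitive and positive definite weight matrices. -/
structure IsWeightMatrix {N : ℕ} (W : Matrix (Fin N) (Fin N) ℝ) : Prop where
  symm : W.IsSymm
  doublyStochastic : W ∈ doublyStochastic ℝ (Fin N)
  primitive : W.IsPrimitive
  posDef : W.PosDef

/-- The mixing rate `λ = ‖W - (1/N) 𝟙𝟙ᵀ‖` (spectral norm). -/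
noncomputable def mixingRate {N : ℕ} (W : Matrix (Fin N) (Fin N) ℝ) : ℝ :=
  ‖Matrix.toEuclideanCLM (n := Fin N) (𝕜 := ℝ) (W - Matrix.of fun _ _ => (N : ℝ)⁻¹)‖

/-- The smallest eigenvalue of `W`. -/
noncomputable def minEigenvalue {N : ℕ} (W : Matrix (Fin N) (Fin N) ℝ) : ℝ :=
  sInf (spectrum ℝ W)

/-- `L`-smoothness: differentiable with `L`-Lipschitz gradient. -/
structure IsLSmooth {m : ℕ} (L : ℝ) (f : Vec m → ℝ) : Prop where
  differentiable : Differentiable ℝ f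
  gradient_lipschitz : ∀ y z, ‖gradient f y - gradient f z‖ ≤ L * ‖y - z‖

/-- The aggregate objective `f = (1/N) ∑ᵢ fᵢ`. -/
noncomputable def aggregate {N m : ℕ} (f : Fin N → Vec m → ℝ) (x : Vec m) : ℝ :=
  (N : ℝ)⁻¹ * ∑ i, f i x

/-- The heterogeneity `ς² = (1/N) ∑ᵢ ‖∇fᵢ(x) - ∇f(x)‖²` at the point `x`. -/
noncomputable def heterogeneity {N m : ℕ} (f : Fin N → Vec m → ℝ) (x : Vec m) : ℝ :=
  (N : ℝ)⁻¹ * ∑ i, ‖gradient (f i) x - gradient (aggregate f) x‖ ^ 2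

section Algorithm

variable {N m : ℕ} {Ξ : Type v}

/-- The stochastic gradient `∇Fᵢ(x; s)`, the gradient being taken in `x`. -/
noncomputable def stochGrad (F : Fin N → Vec m → Ξ → ℝ) (i : Fin N) (x : Vec m) (s : Ξ) : Vec m :=
  gradient (fun z => F i z s) x

/-- The local primal updates of one round, with samples `s t i`:
`φᵢ,₀ = xᵢ` and `φᵢ,ₜ₊₁ = φᵢ,ₜ - α ∇Fᵢ(φᵢ,ₜ; sₜ,ᵢ) - β yᵢ`. -/
noncomputable def localIter (F : Fin N → Vec m → Ξ → ℝ) (α β : ℝ) (s : ℕ → Fin N → Ξ)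
    (x y : Fin N → Vec m) : ℕ → Fin N → Vec m
  | 0 => x
  | t + 1 => fun i =>
      localIter F α β s x y t i
        - α • stochGrad F i (localIter F α β s x y t i) (s t i) - β • y i

/-- The primal and dual variables `(xʳ, yʳ)` of Local Exact-Diffusion with `τ` local updates per
round, run on the samples `s r t i`: with `φ` the result of the local updates,
`xʳ⁺¹ = W φ` and `yʳ⁺¹ = yʳ + φ - xʳ⁺¹`. -/
noncomputable def iter (W : Matrix (Fin N) (Fin N) ℝ) (F : Fin N → Vec m → Ξ → ℝ) (α β : ℝ)
    (τ : ℕ) (s : ℕ → ℕ → Fin N → Ξ) (x0 y0 : Fin N → Vec m) :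
    ℕ → (Fin N → Vec m) × (Fin N → Vec m)
  | 0 => (x0, y0)
  | r + 1 =>
      let p := iter W F α β τ s x0 y0 r
      let φ := localIter F α β (s r) p.1 p.2 τ
      (mix W φ, fun i => p.2 i + φ i - mix W φ i)

/-- The local iterate `φʳᵢ,ₜ`; in particular `φʳᵢ,₀ = xʳᵢ`. -/
noncomputable def phi (W : Matrix (Fin N) (Fin N) ℝ) (F : Fin N → Vec m → Ξ → ℝ) (α β : ℝ)
    (τ : ℕ) (s : ℕ → ℕ → Fin N → Ξ) (x0 y0 : Fin N → Vec m) (r t : ℕ) : Fin N → Vec m :=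
  localIter F α β (s r) (iter W F α β τ s x0 y0 r).1 (iter W F α β τ s x0 y0 r).2 t

/-- The averaged iterate `x̄ʳ`. -/
noncomputable def xbar (W : Matrix (Fin N) (Fin N) ℝ) (F : Fin N → Vec m → Ξ → ℝ) (α β : ℝ)
    (τ : ℕ) (s : ℕ → ℕ → Fin N → Ξ) (x0 y0 : Fin N → Vec m) (r : ℕ) : Vec m :=
  avg (iter W F α β τ s x0 y0 r).1

/-- For a random array `φ r t i` of local iterates (with `τ` local updates per round), the
`σ`-algebra generated by all iterates of all nodes up to the local step `t` of round `r`. -/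
@[reducible]
def history {Ω : Type u} (τ : ℕ) (φ : ℕ → ℕ → Fin N → Ω → Vec m) (r t : ℕ) : MeasurableSpace Ω :=
  ⨆ (q : ℕ) (k : ℕ) (j : Fin N) (_ : (q < r ∧ k ≤ τ) ∨ (q = r ∧ k ≤ t)),
    MeasurableSpace.comap (φ q k j) inferInstance

/-- Independent random data, and stochastic gradients that, conditionally on the iterates so far,
are unbiased with variance at most `σ²`. Here `ξ r t i` is the sample drawn by node `i` at
local step `t` of round `r`, and `φ r t i` is the corresponding local iterate. -/
structure BoundedNoise {Ω : Type u} [MeasurableSpace Ω] (P : Measure Ω) [MeasurableSpace Ξ]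
    (f : Fin N → Vec m → ℝ) (F : Fin N → Vec m → Ξ → ℝ) (σ : ℝ) (τ : ℕ)
    (ξ : ℕ → ℕ → Fin N → Ω → Ξ) (φ : ℕ → ℕ → Fin N → Ω → Vec m) : Prop where
  measurable_sample : ∀ r t i, Measurable (ξ r t i)
  independent :
    iIndepFun (fun (p : ℕ × Fin τ × Fin N) (ω : Ω) => ξ p.1 (p.2.1 : ℕ) p.2.2 ω) P
  memLp : ∀ r t i, t < τ →
    MemLp (fun ω => stochGrad F i (φ r t i ω) (ξ r t i ω) - gradient (f i) (φ r t i ω)) 2 P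
  unbiased : ∀ r t i, t < τ →
    P[fun ω => stochGrad F i (φ r t i ω) (ξ r t i ω) - gradient (f i) (φ r t i ω)
      | history τ φ r t] =ᵐ[P] 0
  variance_le : ∀ r t i, t < τ →
    P[fun ω => ‖stochGrad F i (φ r t i ω) (ξ r t i ω) - gradient (f i) (φ r t i ω)‖ ^ 2
      | history τ φ r t] ≤ᵐ[P] fun _ => σ ^ 2

end Algorithm

end LED

/-! Along every sample path, one round acts on the node average as an inexact gradient step of
length `ατ` on the aggregate: `W` preserves averages and the dual variables average to zero. The
inexactness consists of gradient noise and of the drift caused by evaluating gradients at local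
iterates. `IsRound.drift_le` bounds the drift by the consensus error, the dual deviation, the
squared aggregate gradient and the noise.

The dual variable should track `-ατ(∇fᵢ - ∇f)(x̄)`, which cancels the heterogeneity of the local
steps; `z = dualDev` is its distance to this moving target. With `v` the centred state corrected by
centred drift and noise, a round maps to `W(v - z)` and `Wz + (1 - W)v + η`, where `η` is the
movement of the target. Measure the first in the norm of `W⁻¹` and the second in that of `(1 -
W)⁻¹`. On each eigenvector with eigenvalue `w < 1` the cross terms cancel and, apart from `η`,
exactly `‖v‖² + w‖z‖²/(1 - w)` remains. Mean-zero arrays only see `w ≤ λ` (`eigenvalue_dichotomy`),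
so this energy contracts by about `λ` (`energy_step_le`, `IsRound.energy_next_le`).

Adding a multiple of `ρ = ατL/(1 - λ)` times the energy per node to `‖x̄ - x⋆‖²` gives a Lyapunov
function. When `ρ ≤ 1/100`, its contraction absorbs the drift, and each round gains `ατ` times the
optimality gap and a factor `1 - ατμ/4`, up to noise (`IsRound.lyapunov_next_le`).

Noise enters linearly only against quantities fixed at the start of the round, and otherwise through
squares. By `integral_inner_gradError_eq_zero` the linear part has mean zero and distinct errors of
a round are orthogonal: a sample is independent of all others, so conditional unbiasedness forces
its mean error to vanish at almost every value of the iterate. Orthogonality makes variances grow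
like `τ` and averages gain `1/N`. Telescoping the expected recursion gives the convex bound,
iterating it the strongly convex one. -/

namespace LED

/-! ### Smooth and strongly convex functions -/

section Smooth

variable {m : ℕ} {L μ : ℝ} {f : Vec m → ℝ}

lemma hasDerivAt_along_line (hf : Differentiable ℝ f) (x d : Vec m) (t : ℝ) :
    HasDerivAt (fun s : ℝ => f (x + s • d)) (inner ℝ (gradient f (x + t • d)) d) t := by
  have h1 : HasDerivAt (fun s : ℝ => x + s • d) d t := by
    simpa using ((hasDerivAt_id t).smul_const d).const_add x
  have h2 := (hf (x + t • d)).hasFDerivAt.comp_hasDerivAt t h1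
  rwa [← inner_gradient_left] at h2

lemma IsLSmooth.le_quadratic (h : IsLSmooth L f) (x y : Vec m) :
    f y ≤ f x + inner ℝ (gradient f x) (y - x) + L / 2 * ‖y - x‖ ^ 2 := by
  set d := y - x with hd
  -- Along the segment, subtract the linear term and the claimed quadratic one: the Lipschitz
  -- gradient makes what is left nonincreasing on `[0, 1]`.
  have hder : ∀ t : ℝ, HasDerivAt
      (fun s : ℝ => f (x + s • d) - s * inner ℝ (gradient f x) d - s ^ 2 * (L / 2 * ‖d‖ ^ 2))
      (inner ℝ (gradient f (x + t • d)) d - inner ℝ (gradient f x) d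
        - 2 * t * (L / 2 * ‖d‖ ^ 2)) t := by
    intro t
    have h1 := hasDerivAt_along_line h.differentiable x d t
    have h2 := (hasDerivAt_id t).mul_const (inner ℝ (gradient f x) d)
    have h3 := (hasDerivAt_pow 2 t).mul_const (L / 2 * ‖d‖ ^ 2)
    exact ((h1.sub h2).sub h3).congr_deriv (by simp)
  have hanti := antitoneOn_of_deriv_nonpos (convex_Icc (0 : ℝ) 1)
    (fun t _ => (hder t).continuousAt.continuousWithinAt)
    (fun t _ => (hder t).differentiableAt.differentiableWithinAt)
    (by
      intro t ht
      rw [interior_Icc] at ht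
      rw [(hder t).deriv, ← inner_sub_left]
      have h1 := real_inner_le_norm (gradient f (x + t • d) - gradient f x) d
      have h2 := h.gradient_lipschitz (x + t • d) x
      rw [add_sub_cancel_left, norm_smul, Real.norm_eq_abs, abs_of_pos ht.1] at h2
      nlinarith [mul_le_mul_of_nonneg_right h2 (norm_nonneg d)])
  have h01 := hanti (Set.left_mem_Icc.2 zero_le_one) (Set.right_mem_Icc.2 zero_le_one) zero_le_one
  simp only [hd, one_smul, zero_smul, add_zero, add_sub_cancel] at h01
  rw [hd]
  linarith

lemma strongConvexOn_quadratic_le (hd : Differentiable ℝ f) (hc : StrongConvexOn Set.univ μ f)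
    (x y : Vec m) :
    f x + inner ℝ (gradient f x) (y - x) + μ / 2 * ‖y - x‖ ^ 2 ≤ f y := by
  have hder := hasDerivAt_along_line hd x (y - x) 0
  rw [zero_smul, add_zero] at hder
  have ht := hder.tendsto_slope_zero_right
  -- Strong convexity bounds the difference quotient at `t` by this expression for `0 < t < 1`; let
  -- `t → 0⁺`.
  have hlim : Filter.Tendsto (fun t : ℝ => f y - f x - (1 - t) * (μ / 2 * ‖y - x‖ ^ 2))
      (nhdsWithin 0 (Set.Ioi 0)) (nhds (f y - f x - (1 - 0) * (μ / 2 * ‖y - x‖ ^ 2))) := by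
    apply Filter.Tendsto.mono_left _ nhdsWithin_le_nhds
    apply Continuous.tendsto
    fun_prop
  have hle := le_of_tendsto_of_tendsto ht hlim (by
    have hmem : Set.Ioo (0 : ℝ) 1 ∈ nhdsWithin (0 : ℝ) (Set.Ioi 0) :=
      Ioo_mem_nhdsGT one_pos
    filter_upwards [hmem] with t ht
    have h1 := hc.2 (Set.mem_univ x) (Set.mem_univ y) (sub_nonneg.2 ht.2.le) ht.1.le
      (sub_add_cancel 1 t)
    have h2 : (1 - t) • x + t • y = x + (0 + t) • (y - x) := by
      rw [zero_add, smul_sub, sub_smul, one_smul]; abel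
    rw [h2, norm_sub_rev] at h1
    simp only [smul_eq_mul, zero_smul, add_zero] at h1 ⊢
    rw [inv_mul_le_iff₀ ht.1]
    nlinarith)
  linarith

lemma IsLSmooth.continuous_gradient (h : IsLSmooth L f) : Continuous (gradient f) := by
  refine (LipschitzWith.of_dist_le_mul (K := L.toNNReal) fun x y => ?_).continuous
  rw [dist_eq_norm, dist_eq_norm]
  exact (h.gradient_lipschitz x y).trans
    (mul_le_mul_of_nonneg_right (Real.le_coe_toNNReal L) (norm_nonneg _))

/-- A gradient step of length `1/L` from `x` lowers `f` by at least `‖∇f(x)‖²/(2L)`, yet cannot go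
below the minimum. -/
lemma IsLSmooth.norm_gradient_sq_le (h : IsLSmooth L f) (hL : 0 < L) {xs : Vec m}
    (hmin : ∀ x, f xs ≤ f x) (x : Vec m) :
    ‖gradient f x‖ ^ 2 ≤ 2 * L * (f x - f xs) := by
  have h1 := h.le_quadratic x (x - L⁻¹ • gradient f x)
  have h2 := hmin (x - L⁻¹ • gradient f x)
  rw [sub_sub_cancel_left, inner_neg_right, inner_smul_right, real_inner_self_eq_norm_sq, norm_neg,
    norm_smul, Real.norm_eq_abs, abs_of_pos (inv_pos.2 hL)] at h1
  have h3 : f xs ≤ f x - 1 / (2 * L) * ‖gradient f x‖ ^ 2 := by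
    refine h2.trans (h1.trans (le_of_eq ?_))
    field_simp
    ring
  have h4 : 2 * L * (1 / (2 * L) * ‖gradient f x‖ ^ 2) = ‖gradient f x‖ ^ 2 := by
    field_simp
  nlinarith

lemma gradient_eq_zero_of_forall_le {xs : Vec m} (hmin : ∀ x, f xs ≤ f x) :
    gradient f xs = 0 := by
  have : IsLocalMin f xs := Filter.Eventually.of_forall hmin
  rw [gradient, this.fderiv_eq_zero, map_zero]

lemma IsLSmooth.sub_min_le (h : IsLSmooth L f) {xs : Vec m}
    (hmin : ∀ x, f xs ≤ f x) (x : Vec m) :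
    f x - f xs ≤ L / 2 * ‖x - xs‖ ^ 2 := by
  have := h.le_quadratic xs x
  rw [gradient_eq_zero_of_forall_le hmin, inner_zero_left] at this
  linarith

end Smooth

/-! ### Averages and consensus errors of arrays -/

section Arrays

variable {N m : ℕ}

lemma avg_add (x y : Fin N → Vec m) : avg (fun i => x i + y i) = avg x + avg y := by
  simp only [avg, Finset.sum_add_distrib, smul_add]

lemma avg_sub (x y : Fin N → Vec m) : avg (fun i => x i - y i) = avg x - avg y := by
  simp only [avg, Finset.sum_sub_distrib, smul_sub]

lemma avg_smul (c : ℝ) (x : Fin N → Vec m) : avg (fun i => c • x i) = c • avg x := by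
  simp only [avg, ← Finset.smul_sum, smul_comm c]

lemma avg_const (hN : 0 < N) (p : Vec m) : avg (fun _ : Fin N => p) = p := by
  have : (N : ℝ) ≠ 0 := by positivity
  simp only [avg, Finset.sum_const, Finset.card_univ, Fintype.card_fin, ← Nat.cast_smul_eq_nsmul ℝ,
    smul_smul, inv_mul_cancel₀ this, one_smul]

lemma avg_centered (hN : 0 < N) (x : Fin N → Vec m) : avg (fun i => x i - avg x) = 0 := by
  rw [avg_sub, avg_const hN, sub_self]

lemma sum_eq_smul_avg (hN : 0 < N) (x : Fin N → Vec m) : ∑ i, x i = (N : ℝ) • avg x := by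
  have : (N : ℝ) ≠ 0 := by positivity
  rw [avg, smul_smul, mul_inv_cancel₀ this, one_smul]

lemma sum_eq_zero_of_avg (hN : 0 < N) {x : Fin N → Vec m} (h : avg x = 0) : ∑ i, x i = 0 := by
  rw [sum_eq_smul_avg hN, h, smul_zero]

lemma avg_eq_zero_of_sum {x : Fin N → Vec m} (h : ∑ i, x i = 0) : avg x = 0 := by
  rw [avg, h, smul_zero]

lemma consensusError_eq (hN : 0 < N) (x : Fin N → Vec m) :
    consensusError x = ∑ i, ‖x i‖ ^ 2 - N * ‖avg x‖ ^ 2 := by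
  simp only [consensusError, norm_sub_sq_real, Finset.sum_add_distrib, Finset.sum_sub_distrib,
    Finset.sum_const, Finset.card_univ, Fintype.card_fin, nsmul_eq_mul, ← Finset.mul_sum]
  rw [← sum_inner, sum_eq_smul_avg hN, inner_smul_left, real_inner_self_eq_norm_sq]
  simp
  ring

lemma consensusError_le (hN : 0 < N) (x : Fin N → Vec m) :
    consensusError x ≤ ∑ i, ‖x i‖ ^ 2 := by
  rw [consensusError_eq hN]
  have : 0 ≤ (N : ℝ) * ‖avg x‖ ^ 2 := by positivity
  linarith

lemma consensusError_nonneg (x : Fin N → Vec m) : 0 ≤ consensusError x :=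
  Finset.sum_nonneg fun _ _ => sq_nonneg _

lemma norm_avg_sq_le (hN : 0 < N) (x : Fin N → Vec m) :
    N * ‖avg x‖ ^ 2 ≤ ∑ i, ‖x i‖ ^ 2 := by
  have := consensusError_eq hN x
  have h2 := consensusError_nonneg x
  linarith

lemma sum_inner_centered (hN : 0 < N) {a : Fin N → Vec m} (ha : avg a = 0) (s : Fin N → Vec m) :
    ∑ i, inner ℝ (a i) (s i - avg s) = ∑ i, inner ℝ (a i) (s i) := by
  simp only [inner_sub_right, Finset.sum_sub_distrib]
  rw [← sum_inner, sum_eq_zero_of_avg hN ha, inner_zero_left, sub_zero]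

lemma norm_sum_sq_le {ι E : Type*} [SeminormedAddCommGroup E] (s : Finset ι) (x : ι → E) :
    ‖∑ t ∈ s, x t‖ ^ 2 ≤ s.card * ∑ t ∈ s, ‖x t‖ ^ 2 :=
  (pow_le_pow_left₀ (norm_nonneg _) (norm_sum_le _ _) 2).trans sq_sum_le_card_mul_sum_sq

end Arrays

/-! ### Smoothness of the aggregate objective -/

section Aggregate

variable {N m : ℕ} {L : ℝ} {f : Fin N → Vec m → ℝ}

lemma hasGradientAt_aggregate (hf : ∀ i, IsLSmooth L (f i)) (x : Vec m) :
    HasGradientAt (aggregate f) (avg fun i => gradient (f i) x) x := by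
  rw [hasGradientAt_iff_hasFDerivAt]
  have h : ∀ i ∈ Finset.univ, HasFDerivAt (f i) (fderiv ℝ (f i) x) x := fun i _ =>
    ((hf i).differentiable x).hasFDerivAt
  refine ((HasFDerivAt.fun_sum h).const_mul (N : ℝ)⁻¹).congr_fderiv ?_
  simp only [avg, map_smulₛₗ, map_sum, toDual_gradient, conj_trivial]

lemma gradient_aggregate (hf : ∀ i, IsLSmooth L (f i)) (x : Vec m) :
    gradient (aggregate f) x = avg fun i => gradient (f i) x :=
  (hasGradientAt_aggregate hf x).gradient

lemma isLSmooth_aggregate (hN : 0 < N) (hf : ∀ i, IsLSmooth L (f i)) :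
    IsLSmooth L (aggregate f) where
  differentiable x := (hasGradientAt_aggregate hf x).differentiableAt
  gradient_lipschitz y z := by
    have hN' : (0 : ℝ) < N := by exact_mod_cast hN
    rw [gradient_aggregate hf, gradient_aggregate hf, ← avg_sub, avg, norm_smul, norm_inv,
      Real.norm_natCast, inv_mul_le_iff₀ hN']
    refine (norm_sum_le _ _).trans ((Finset.sum_le_sum fun i _ =>
      (hf i).gradient_lipschitz y z).trans (le_of_eq ?_))
    simp

end Aggregate

/-! ### Spectral decomposition of the weight matrix -/

section Modes

variable {N m : ℕ} {W : Matrix (Fin N) (Fin N) ℝ}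

/-- The component of the array `x` along the `k`-th eigenvector of `W`. -/
noncomputable def modeCoef (hW : W.IsHermitian) (k : Fin N) (x : Fin N → Vec m) : Vec m :=
  ∑ i, hW.eigenvectorBasis k i • x i

lemma modeCoef_add (hW : W.IsHermitian) (k : Fin N) (x y : Fin N → Vec m) :
    modeCoef hW k (fun i => x i + y i) = modeCoef hW k x + modeCoef hW k y := by
  simp only [modeCoef, smul_add, Finset.sum_add_distrib]

lemma modeCoef_sub (hW : W.IsHermitian) (k : Fin N) (x y : Fin N → Vec m) :
    modeCoef hW k (fun i => x i - y i) = modeCoef hW k x - modeCoef hW k y := by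
  simp only [modeCoef, smul_sub, Finset.sum_sub_distrib]

lemma sum_norm_sq_modeCoef (hW : W.IsHermitian) (x : Fin N → Vec m) :
    ∑ k, ‖modeCoef hW k x‖ ^ 2 = ∑ i, ‖x i‖ ^ 2 := by
  simp only [EuclideanSpace.real_norm_sq_eq]
  rw [Finset.sum_comm, Finset.sum_comm (s := (Finset.univ : Finset (Fin N)))
    (f := fun i c => x i c ^ 2)]
  refine Finset.sum_congr rfl fun c _ => ?_
  have h := hW.eigenvectorBasis.sum_sq_norm_inner_right (WithLp.toLp 2 fun i => x i c)
  rw [EuclideanSpace.real_norm_sq_eq] at h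
  rw [← h]
  refine Finset.sum_congr rfl fun k _ => ?_
  rw [Real.norm_eq_abs, sq_abs]
  congr 1
  simp [modeCoef, PiLp.inner_apply, mul_comm]

lemma sum_eigenvectorBasis_mul (hW : W.IsHermitian) (k j : Fin N) :
    ∑ i, hW.eigenvectorBasis k i * W i j = hW.eigenvalues k * hW.eigenvectorBasis k j := by
  have h := congrFun (hW.mulVec_eigenvectorBasis k) j
  simp only [Matrix.mulVec, dotProduct, Pi.smul_apply, smul_eq_mul] at h
  rw [← h]
  refine Finset.sum_congr rfl fun i _ => ?_
  have := hW.apply i j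
  simp only [star_trivial] at this
  rw [this, mul_comm]

lemma modeCoef_mix (hW : W.IsHermitian) (k : Fin N) (x : Fin N → Vec m) :
    modeCoef hW k (mix W x) = hW.eigenvalues k • modeCoef hW k x := by
  simp only [modeCoef, mix, Finset.smul_sum, smul_smul]
  rw [Finset.sum_comm]
  refine Finset.sum_congr rfl fun j _ => ?_
  rw [← Finset.sum_smul, sum_eigenvectorBasis_mul]

lemma mix_const (hW : IsWeightMatrix W) (p : Vec m) (i : Fin N) : mix W (fun _ => p) i = p := by
  rw [mix, ← Finset.sum_smul, sum_row_of_mem_doublyStochastic hW.doublyStochastic, one_smul]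

lemma mix_sub (x y : Fin N → Vec m) (i : Fin N) :
    mix W (fun j => x j - y j) i = mix W x i - mix W y i := by
  simp only [mix, smul_sub, Finset.sum_sub_distrib]

lemma avg_mix (hW : IsWeightMatrix W) (x : Fin N → Vec m) : avg (mix W x) = avg x := by
  simp only [avg, mix]
  rw [Finset.sum_comm]
  congr 1
  refine Finset.sum_congr rfl fun j _ => ?_
  rw [← Finset.sum_smul, sum_col_of_mem_doublyStochastic hW.doublyStochastic, one_smul]

/-- The vector on the left is `W - (1/N)𝟙𝟙ᵀ` applied to `e`. -/
lemma norm_sub_mean_le {e : EuclideanSpace ℝ (Fin N)} {w s : ℝ}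
    (he : ∀ i, ∑ j, W i j * e j = w * e i) (hs : s = (N : ℝ)⁻¹ * ∑ j, e j) :
    ‖(WithLp.toLp 2 fun i => w * e i - s : EuclideanSpace ℝ (Fin N))‖ ≤ mixingRate W * ‖e‖ := by
  refine le_trans (le_of_eq ?_) (ContinuousLinearMap.le_opNorm _ e)
  congr 1
  ext i
  rw [Matrix.ofLp_toEuclideanCLM]
  simp only [Matrix.mulVec, dotProduct, Matrix.sub_apply, Matrix.of_apply, sub_mul,
    Finset.sum_sub_distrib, he, ← Finset.mul_sum, hs]

/-- Unit column sums give `∑ eⱼ = w ∑ eⱼ` for an eigenvector `e`. If the sum vanishes, `e` is an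
eigenvector of `W - (1/N)𝟙𝟙ᵀ` too, so `w ≤ λ`. Otherwise `w = 1`, and the centred part of `e` is
fixed by a map of norm below one; hence it is zero, `e` is constant, and mean-zero arrays have no
component along it. So the terms with `1 - w = 0` in `dualEnergy` have zero numerator on such
arrays. -/
lemma eigenvalue_dichotomy (hW : IsWeightMatrix W) (hl : mixingRate W < 1) (k : Fin N) :
    (hW.posDef.isHermitian.eigenvalues k ≤ mixingRate W) ∨
      (hW.posDef.isHermitian.eigenvalues k = 1 ∧
        ∀ x : Fin N → Vec m, avg x = 0 → modeCoef hW.posDef.isHermitian k x = 0) := by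
  have hN : 0 < N := Fin.pos k
  have hN' : (N : ℝ) ≠ 0 := by positivity
  set hH := hW.posDef.isHermitian
  set e := hH.eigenvectorBasis k
  set w := hH.eigenvalues k
  have he : ∀ i, ∑ j, W i j * e j = w * e i := fun i => congrFun (hH.mulVec_eigenvectorBasis k) i
  have hnorm : ‖e‖ = 1 := hH.eigenvectorBasis.norm_eq_one k
  have hsum : ∑ j, e j = w * ∑ j, e j := by
    have h := Finset.sum_congr rfl fun i (_ : i ∈ Finset.univ) => he i
    rw [Finset.sum_comm, ← Finset.mul_sum] at h
    simpa only [← Finset.sum_mul, sum_col_of_mem_doublyStochastic hW.doublyStochastic, one_mul]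
      using h
  by_cases h0 : ∑ j, e j = 0
  · left
    have h := norm_sub_mean_le he (s := 0) (by rw [h0, mul_zero])
    have h2 : (WithLp.toLp 2 fun i => w * e i - 0 : EuclideanSpace ℝ (Fin N)) = w • e := by
      ext i; simp
    rw [h2, norm_smul, hnorm, mul_one, mul_one] at h
    exact (le_abs_self w).trans h
  · right
    have hw : w = 1 := by
      have : (w - 1) * ∑ j, e j = 0 := by linarith
      rcases mul_eq_zero.1 this with h | h
      · linarith
      · exact absurd h h0
    refine ⟨hw, fun x hx => ?_⟩
    set s := (N : ℝ)⁻¹ * ∑ j, e j with hs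
    set d : EuclideanSpace ℝ (Fin N) := WithLp.toLp 2 fun i => e i - s
    have hd : ∀ i, ∑ j, W i j * d j = 1 * d i := by
      intro i
      simp only [d, mul_sub, Finset.sum_sub_distrib, he, ← Finset.sum_mul,
        sum_row_of_mem_doublyStochastic hW.doublyStochastic, hw, one_mul]
    have hds : (0 : ℝ) = (N : ℝ)⁻¹ * ∑ j, d j := by
      simp only [d, Finset.sum_sub_distrib, Finset.sum_const, Finset.card_univ, Fintype.card_fin,
        nsmul_eq_mul, hs]
      field_simp
      simp
    have h := norm_sub_mean_le hd hds
    have h2 : (WithLp.toLp 2 fun i => 1 * d i - 0 : EuclideanSpace ℝ (Fin N)) = d := by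
      ext i; simp
    rw [h2] at h
    have h3 : ‖d‖ = 0 := by
      by_contra hne
      have : 0 < ‖d‖ := lt_of_le_of_ne (norm_nonneg _) (Ne.symm hne)
      nlinarith
    have h4 : ∀ i, e i = s := fun i => by
      have := congrArg (fun v : EuclideanSpace ℝ (Fin N) => v i) (norm_eq_zero.1 h3)
      simpa [d, sub_eq_zero] using this
    change ∑ i, e i • x i = 0
    simp only [h4, ← Finset.smul_sum, sum_eq_zero_of_avg hN hx, smul_zero]

lemma mixingRate_nonneg : 0 ≤ mixingRate W := norm_nonneg _

lemma minEigenvalue_le (hW : IsWeightMatrix W) (k : Fin N) :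
    minEigenvalue W ≤ hW.posDef.isHermitian.eigenvalues k := by
  refine csInf_le ?_ (hW.posDef.isHermitian.eigenvalues_mem_spectrum_real k)
  rw [hW.posDef.isHermitian.spectrum_real_eq_range_eigenvalues]
  exact (Set.finite_range _).bddBelow

lemma minEigenvalue_pos (hN : 0 < N) (hW : IsWeightMatrix W) : 0 < minEigenvalue W := by
  have : Nonempty (Fin N) := ⟨⟨0, hN⟩⟩
  have h : minEigenvalue W ∈ Set.range hW.posDef.isHermitian.eigenvalues := by
    rw [minEigenvalue, hW.posDef.isHermitian.spectrum_real_eq_range_eigenvalues]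
    exact (Set.range_nonempty _).csInf_mem (Set.finite_range _)
  obtain ⟨k, hk⟩ := h
  rw [← hk]
  exact hW.posDef.eigenvalues_pos k

lemma minEigenvalue_le_one (hN : 0 < N) (hW : IsWeightMatrix W) (hl : mixingRate W < 1) :
    minEigenvalue W ≤ 1 := by
  refine (minEigenvalue_le hW ⟨0, hN⟩).trans ?_
  rcases eigenvalue_dichotomy (m := 0) hW hl ⟨0, hN⟩ with h | h
  · linarith
  · exact h.1.le

end Modes

/-! ### Primal and dual energies and their contraction under mixing -/

section Energy

variable {N m : ℕ} {W : Matrix (Fin N) (Fin N) ℝ}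

/-- The quadratic form `⟨x, W⁻¹ x⟩`, in the eigenbasis of `W`. -/
noncomputable def primalEnergy (hW : W.IsHermitian) (x : Fin N → Vec m) : ℝ :=
  ∑ k, ‖modeCoef hW k x‖ ^ 2 / hW.eigenvalues k

/-- The quadratic form `⟨z, (1 - W)⁻¹ z⟩` on arrays of mean zero, in the eigenbasis of `W`. -/
noncomputable def dualEnergy (hW : W.IsHermitian) (z : Fin N → Vec m) : ℝ :=
  ∑ k, ‖modeCoef hW k z‖ ^ 2 / (1 - hW.eigenvalues k)

lemma norm_add_sq_le_of_pos {E : Type*} [SeminormedAddCommGroup E] [InnerProductSpace ℝ E]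
    {ε : ℝ} (hε : 0 < ε) (a b : E) :
    ‖a + b‖ ^ 2 ≤ (1 + ε) * ‖a‖ ^ 2 + (1 + 1 / ε) * ‖b‖ ^ 2 := by
  have h1 := norm_add_le a b
  have h2 : ‖a + b‖ ^ 2 ≤ (‖a‖ + ‖b‖) ^ 2 := pow_le_pow_left₀ (norm_nonneg _) h1 2
  have h3 : 0 ≤ (ε * ‖a‖ - ‖b‖) ^ 2 / ε := by positivity
  have h4 : (ε * ‖a‖ - ‖b‖) ^ 2 / ε = ε * ‖a‖ ^ 2 - 2 * ‖a‖ * ‖b‖ + 1 / ε * ‖b‖ ^ 2 := by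
    field_simp
    ring
  nlinarith

lemma sum_norm_sq_le_primalEnergy (hW : IsWeightMatrix W) (hl : mixingRate W < 1)
    {x : Fin N → Vec m} (hx : avg x = 0) :
    ∑ i, ‖x i‖ ^ 2 ≤ mixingRate W * primalEnergy hW.posDef.isHermitian x := by
  rw [← sum_norm_sq_modeCoef hW.posDef.isHermitian, primalEnergy, Finset.mul_sum]
  refine Finset.sum_le_sum fun k _ => ?_
  have hpos := hW.posDef.eigenvalues_pos k
  rcases eigenvalue_dichotomy (m := m) hW hl k with h | h
  · rw [mul_div_assoc', le_div_iff₀ hpos, mul_comm]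
    exact mul_le_mul_of_nonneg_right h (sq_nonneg _)
  · simp [h.2 x hx]

lemma sum_norm_sq_le_dualEnergy (hW : IsWeightMatrix W) (hl : mixingRate W < 1)
    {z : Fin N → Vec m} (hz : avg z = 0) :
    ∑ i, ‖z i‖ ^ 2 ≤ dualEnergy hW.posDef.isHermitian z := by
  rw [← sum_norm_sq_modeCoef hW.posDef.isHermitian, dualEnergy]
  refine Finset.sum_le_sum fun k _ => ?_
  have hpos := hW.posDef.eigenvalues_pos k
  rcases eigenvalue_dichotomy (m := m) hW hl k with h | h
  · rw [le_div_iff₀ (by linarith)]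
    nlinarith [sq_nonneg ‖modeCoef hW.posDef.isHermitian k z‖]
  · simp [h.2 z hz]

lemma dualEnergy_le (hW : IsWeightMatrix W) (hl : mixingRate W < 1)
    {z : Fin N → Vec m} (hz : avg z = 0) :
    dualEnergy hW.posDef.isHermitian z ≤ (∑ i, ‖z i‖ ^ 2) / (1 - mixingRate W) := by
  rw [← sum_norm_sq_modeCoef hW.posDef.isHermitian, dualEnergy, Finset.sum_div]
  refine Finset.sum_le_sum fun k _ => ?_
  rcases eigenvalue_dichotomy (m := m) hW hl k with h | h
  · exact div_le_div_of_nonneg_left (sq_nonneg _) (by linarith) (by linarith)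
  · simp [h.2 z hz]

lemma primalEnergy_le (hN : 0 < N) (hW : IsWeightMatrix W) (x : Fin N → Vec m) :
    primalEnergy hW.posDef.isHermitian x ≤ (∑ i, ‖x i‖ ^ 2) / minEigenvalue W := by
  rw [← sum_norm_sq_modeCoef hW.posDef.isHermitian, primalEnergy, Finset.sum_div]
  exact Finset.sum_le_sum fun k _ =>
    div_le_div_of_nonneg_left (sq_nonneg _) (minEigenvalue_pos hN hW) (minEigenvalue_le hW k)

/-- For the initialisation `y = (1 - W)x`: the factor `(1 - w)²` from the numerator beats the
denominator `1 - w`, so the consensus error enters without `1/(1 - λ)`. -/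
lemma dualEnergy_sub_mix_add_le (hW : IsWeightMatrix W) (hl : mixingRate W < 1)
    {x b : Fin N → Vec m} (hx : avg x = 0) (hb : avg b = 0) :
    dualEnergy hW.posDef.isHermitian (fun i => (x i - mix W x i) + b i) ≤
      2 * ∑ i, ‖x i‖ ^ 2 + 2 * ((∑ i, ‖b i‖ ^ 2) / (1 - mixingRate W)) := by
  rw [← sum_norm_sq_modeCoef hW.posDef.isHermitian x, ← sum_norm_sq_modeCoef
    hW.posDef.isHermitian b, dualEnergy, Finset.sum_div, Finset.mul_sum, Finset.mul_sum,
    ← Finset.sum_add_distrib]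
  refine Finset.sum_le_sum fun k _ => ?_
  rw [modeCoef_add, modeCoef_sub hW.posDef.isHermitian k x (mix W x), modeCoef_mix]
  have hpos := hW.posDef.eigenvalues_pos k
  rcases eigenvalue_dichotomy (m := m) hW hl k with h | h
  · set w := hW.posDef.isHermitian.eigenvalues k
    set p := modeCoef hW.posDef.isHermitian k x
    set q := modeCoef hW.posDef.isHermitian k b
    have hw : 0 < 1 - w := by linarith
    have hl' : 0 < 1 - mixingRate W := by linarith
    have h1 := norm_add_sq_le_of_pos one_pos (p - w • p) q
    have h2 : ‖p - w • p‖ ^ 2 = (1 - w) ^ 2 * ‖p‖ ^ 2 := by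
      rw [show p - w • p = (1 - w) • p by rw [sub_smul, one_smul], norm_smul, mul_pow,
        Real.norm_eq_abs, sq_abs]
    have h3 : ‖q‖ ^ 2 / (1 - w) ≤ ‖q‖ ^ 2 / (1 - mixingRate W) :=
      div_le_div_of_nonneg_left (sq_nonneg _) hl' (by linarith)
    have h4 : ‖p - w • p + q‖ ^ 2 / (1 - w) ≤
        (2 * ((1 - w) ^ 2 * ‖p‖ ^ 2) + 2 * ‖q‖ ^ 2) / (1 - w) :=
      div_le_div_of_nonneg_right (by rw [← h2]; linarith) hw.le
    have h5 : (2 * ((1 - w) ^ 2 * ‖p‖ ^ 2) + 2 * ‖q‖ ^ 2) / (1 - w)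
        = 2 * ((1 - w) * ‖p‖ ^ 2) + 2 * (‖q‖ ^ 2 / (1 - w)) := by
      field_simp
    nlinarith [sq_nonneg ‖p‖]
  · simp [h.2 x hx, h.2 b hb]

/-- Without `η` the two weighted squares add up to an exact identity in each mode, with `w ≤ λ` in
front of the dual part. The perturbation `η` is split off by Young's inequality with parameter `ε`.
-/
lemma energy_step_le (hW : IsWeightMatrix W) (hl : mixingRate W < 1)
    {v z η : Fin N → Vec m} (hv : avg v = 0) (hz : avg z = 0) (hη : avg η = 0)
    {ε : ℝ} (hε : 0 < ε) :
    primalEnergy hW.posDef.isHermitian (mix W fun i => v i - z i) +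
        dualEnergy hW.posDef.isHermitian
          (fun i => (mix W z i + (v i - mix W v i)) + η i) ≤
      (1 + ε) * (∑ i, ‖v i‖ ^ 2 + mixingRate W * dualEnergy hW.posDef.isHermitian z)
        + (1 + 1 / ε) * ((∑ i, ‖η i‖ ^ 2) / (1 - mixingRate W)) := by
  rw [← sum_norm_sq_modeCoef hW.posDef.isHermitian v, ← sum_norm_sq_modeCoef
    hW.posDef.isHermitian η, primalEnergy, dualEnergy, dualEnergy, Finset.sum_div, Finset.mul_sum,
    ← Finset.sum_add_distrib, ← Finset.sum_add_distrib, Finset.mul_sum, Finset.mul_sum,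
    ← Finset.sum_add_distrib]
  refine Finset.sum_le_sum fun k _ => ?_
  rw [modeCoef_mix, modeCoef_add, modeCoef_add hW.posDef.isHermitian k (mix W z), modeCoef_mix,
    modeCoef_sub, modeCoef_sub hW.posDef.isHermitian k v (mix W v), modeCoef_mix]
  have hpos := hW.posDef.eigenvalues_pos k
  rcases eigenvalue_dichotomy (m := m) hW hl k with h | h
  · set w := hW.posDef.isHermitian.eigenvalues k
    set p := modeCoef hW.posDef.isHermitian k v
    set q := modeCoef hW.posDef.isHermitian k z
    set g := modeCoef hW.posDef.isHermitian k η
    have hw : 0 < 1 - w := by linarith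
    have hl' : 0 < 1 - mixingRate W := by linarith
    have h1 := norm_add_sq_le_of_pos hε (w • q + (p - w • p)) g
    have h2 : ‖w • q + (p - w • p)‖ ^ 2
        = w ^ 2 * ‖q‖ ^ 2 + 2 * (w * (1 - w)) * inner ℝ q p + (1 - w) ^ 2 * ‖p‖ ^ 2 := by
      rw [show p - w • p = (1 - w) • p by rw [sub_smul, one_smul], norm_add_sq_real, norm_smul,
        norm_smul, mul_pow, mul_pow, Real.norm_eq_abs, sq_abs, Real.norm_eq_abs, sq_abs,
        inner_smul_left, inner_smul_right]
      simp only [conj_trivial]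
      ring
    have h3 : ‖w • (p - q)‖ ^ 2 = w ^ 2 * (‖p‖ ^ 2 - 2 * inner ℝ q p + ‖q‖ ^ 2) := by
      rw [norm_smul, mul_pow, norm_sub_sq_real, Real.norm_eq_abs, sq_abs, real_inner_comm]
    have h4 : ‖g‖ ^ 2 / (1 - w) ≤ ‖g‖ ^ 2 / (1 - mixingRate W) :=
      div_le_div_of_nonneg_left (sq_nonneg _) hl' (by linarith)
    -- The weights `1/w` and `1/(1 - w)` are exactly those for which the inner products of `p` and
    -- `q` cancel.
    have h5 : ‖w • (p - q)‖ ^ 2 / w + ‖w • q + (p - w • p)‖ ^ 2 / (1 - w)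
        = ‖p‖ ^ 2 + w * (‖q‖ ^ 2 / (1 - w)) := by
      rw [h2, h3]
      field_simp
      ring
    have h6 : ‖w • q + (p - w • p) + g‖ ^ 2 / (1 - w) ≤
        (1 + ε) * (‖w • q + (p - w • p)‖ ^ 2 / (1 - w)) + (1 + 1 / ε) * (‖g‖ ^ 2 / (1 - w)) := by
      rw [mul_div_assoc', mul_div_assoc', ← add_div]
      exact div_le_div_of_nonneg_right h1 hw.le
    have h7 : (1 + 1 / ε) * (‖g‖ ^ 2 / (1 - w)) ≤ (1 + 1 / ε) * (‖g‖ ^ 2 / (1 - mixingRate W)) :=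
      mul_le_mul_of_nonneg_left h4 (by positivity)
    have h8 : w * (‖q‖ ^ 2 / (1 - w)) ≤ mixingRate W * (‖q‖ ^ 2 / (1 - w)) :=
      mul_le_mul_of_nonneg_right h (by positivity)
    have h9 : 0 ≤ ε * (‖w • (p - q)‖ ^ 2 / w) := by positivity
    nlinarith
  · simp [h.2 v hv, h.2 z hz, h.2 η hη]

lemma primalEnergy_nonneg (hW : IsWeightMatrix W) (x : Fin N → Vec m) :
    0 ≤ primalEnergy hW.posDef.isHermitian x :=
  Finset.sum_nonneg fun k _ => div_nonneg (sq_nonneg _) (hW.posDef.eigenvalues_pos k).le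

end Energy

/-! ### One round of local updates: drift and averaged dynamics -/

section Round

variable {N m τ : ℕ} {W : Matrix (Fin N) (Fin N) ℝ} {L μ α : ℝ} {f : Fin N → Vec m → ℝ}
  {x y : Fin N → Vec m} {φ n : ℕ → Fin N → Vec m} {xs : Vec m}

/-- One round of local updates started at `x` with dual variable `y`, where `n t i` is the
error of the stochastic gradient used by node `i` at local step `t`. -/
structure IsRound (f : Fin N → Vec m → ℝ) (α : ℝ) (τ : ℕ) (x y : Fin N → Vec m)
    (φ n : ℕ → Fin N → Vec m) : Prop where
  zero : φ 0 = x
  succ : ∀ t i, φ (t + 1) i =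
    φ t i - α • (gradient (f i) (φ t i) + n t i) - (1 / (τ : ℝ)) • y i

/-- The dual variable recentred at `-ατ (∇fᵢ - ∇f)` evaluated at the node average. -/
noncomputable def dualDev (f : Fin N → Vec m → ℝ) (α : ℝ) (τ : ℕ) (x y : Fin N → Vec m) :
    Fin N → Vec m :=
  fun i => y i + (α * τ) • (gradient (f i) (avg x) - gradient (aggregate f) (avg x))

/-- The accumulated squared distance of the local iterates to the starting average. -/
noncomputable def drift (τ : ℕ) (x : Fin N → Vec m) (φ : ℕ → Fin N → Vec m) : ℝ :=
  ∑ t ∈ Finset.range τ, ∑ i, ‖φ t i - avg x‖ ^ 2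

/-- The accumulated squared norm of the partial sums of the gradient errors. -/
noncomputable def noiseDrift (τ : ℕ) (n : ℕ → Fin N → Vec m) : ℝ :=
  ∑ t ∈ Finset.range τ, ∑ i, ‖∑ s ∈ Finset.range t, n s i‖ ^ 2

/-- The accumulated change of the local gradients during a round. -/
noncomputable def gradDrift (f : Fin N → Vec m → ℝ) (τ : ℕ) (x : Fin N → Vec m)
    (φ : ℕ → Fin N → Vec m) : Fin N → Vec m :=
  fun i => ∑ t ∈ Finset.range τ, (gradient (f i) (φ t i) - gradient (f i) (avg x))

/-- The gradient errors accumulated during a round. -/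
noncomputable def noiseSum (τ : ℕ) (n : ℕ → Fin N → Vec m) : Fin N → Vec m :=
  fun i => ∑ s ∈ Finset.range τ, n s i

lemma drift_nonneg (x : Fin N → Vec m) (φ : ℕ → Fin N → Vec m) : 0 ≤ drift τ x φ :=
  Finset.sum_nonneg fun _ _ => Finset.sum_nonneg fun _ _ => sq_nonneg _

/-- Each local step subtracts `α∇fᵢ(x̄) + yᵢ/τ = zᵢ/τ + α∇f(x̄)`, where `z` is `dualDev`, apart from
noise and change of gradient. Thus heterogeneity acts only through `z`. -/
lemma IsRound.sub_avg_eq (h : IsRound f α τ x y φ n) (hτ : 0 < τ) (t : ℕ) (i : Fin N) :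
    φ t i - avg x = (x i - avg x)
      - α • ∑ s ∈ Finset.range t, (gradient (f i) (φ s i) - gradient (f i) (avg x))
      - ((t : ℝ) / τ) • dualDev f α τ x y i - (α * t) • gradient (aggregate f) (avg x)
      - α • ∑ s ∈ Finset.range t, n s i := by
  have hτ' : (τ : ℝ) ≠ 0 := by positivity
  induction t with
  | zero => simp [h.zero]
  | succ t ih =>
    rw [h.succ, Finset.sum_range_succ, Finset.sum_range_succ, sub_right_comm _ _ (avg x),
      sub_right_comm _ _ (avg x), ih, dualDev]
    push_cast
    match_scalars <;> field_simp <;> ring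

lemma norm_sub_four_sq_le {E : Type*} [SeminormedAddCommGroup E] (a b c d e : E) :
    ‖a - b - c - d - e‖ ^ 2 ≤
      5 * (‖a‖ ^ 2 + ‖b‖ ^ 2 + ‖c‖ ^ 2 + ‖d‖ ^ 2 + ‖e‖ ^ 2) := by
  have h : ‖a - b - c - d - e‖ ≤ ‖a‖ + ‖b‖ + ‖c‖ + ‖d‖ + ‖e‖ :=
    (norm_sub_le _ _).trans (add_le_add_left ((norm_sub_le _ _).trans (add_le_add_left
      ((norm_sub_le _ _).trans (add_le_add_left (norm_sub_le _ _) _)) _)) _)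
  have h2 := pow_le_pow_left₀ (norm_nonneg _) h 2
  nlinarith [sq_nonneg (‖a‖ - ‖b‖), sq_nonneg (‖a‖ - ‖c‖), sq_nonneg (‖a‖ - ‖d‖),
    sq_nonneg (‖a‖ - ‖e‖), sq_nonneg (‖b‖ - ‖c‖), sq_nonneg (‖b‖ - ‖d‖), sq_nonneg (‖b‖ - ‖e‖),
    sq_nonneg (‖c‖ - ‖d‖), sq_nonneg (‖c‖ - ‖e‖), sq_nonneg (‖d‖ - ‖e‖)]

lemma norm_smul_sq {E : Type*} [SeminormedAddCommGroup E] [NormedSpace ℝ E] (c : ℝ) (a : E) :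
    ‖c • a‖ ^ 2 = c ^ 2 * ‖a‖ ^ 2 := by
  rw [norm_smul, mul_pow, Real.norm_eq_abs, sq_abs]

lemma sum_norm_gradient_sub_sq_le (hf : ∀ i, IsLSmooth L (f i)) (t : ℕ) (ht : t ≤ τ)
    (i : Fin N) :
    ‖∑ s ∈ Finset.range t, (gradient (f i) (φ s i) - gradient (f i) (avg x))‖ ^ 2 ≤
      τ * (L ^ 2 * ∑ s ∈ Finset.range τ, ‖φ s i - avg x‖ ^ 2) := by
  refine (norm_sum_sq_le _ _).trans ?_
  rw [Finset.card_range]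
  have htc : (t : ℝ) ≤ τ := by exact_mod_cast ht
  refine mul_le_mul htc ?_ (Finset.sum_nonneg fun _ _ => sq_nonneg _) (Nat.cast_nonneg _)
  rw [Finset.mul_sum]
  refine (Finset.sum_le_sum_of_subset_of_nonneg (Finset.range_mono ht)
    (fun _ _ _ => sq_nonneg _)).trans (Finset.sum_le_sum fun s _ => ?_)
  rw [← mul_pow]
  exact pow_le_pow_left₀ (norm_nonneg _) ((hf i).gradient_lipschitz _ _) 2

lemma sum_norm_gradDrift_sq_le (hf : ∀ i, IsLSmooth L (f i)) :
    ∑ i, ‖gradDrift f τ x φ i‖ ^ 2 ≤ τ * (L ^ 2 * drift τ x φ) := by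
  rw [drift, Finset.sum_comm, Finset.mul_sum, Finset.mul_sum]
  exact Finset.sum_le_sum fun i _ => sum_norm_gradient_sub_sq_le hf τ le_rfl i

lemma IsRound.drift_le (h : IsRound f α τ x y φ n) (hτ : 0 < τ)
    (hf : ∀ i, IsLSmooth L (f i)) (hθ : 10 * (α * τ * L) ^ 2 ≤ 1) :
    drift τ x φ ≤ 10 * (τ * (∑ i, ‖x i - avg x‖ ^ 2 + ∑ i, ‖dualDev f α τ x y i‖ ^ 2)
      + τ * (N * (α ^ 2 * τ ^ 2 * ‖gradient (aggregate f) (avg x)‖ ^ 2))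
      + α ^ 2 * noiseDrift τ n) := by
  have hτ' : (0 : ℝ) < τ := by exact_mod_cast hτ
  set g := gradient (aggregate f) (avg x)
  have key : ∀ t ∈ Finset.range τ, ∑ i, ‖φ t i - avg x‖ ^ 2 ≤
      5 * (∑ i, ‖x i - avg x‖ ^ 2 + α ^ 2 * (τ * (L ^ 2 * drift τ x φ))
        + ∑ i, ‖dualDev f α τ x y i‖ ^ 2 + N * (α ^ 2 * τ ^ 2 * ‖g‖ ^ 2)
        + α ^ 2 * ∑ i, ‖∑ s ∈ Finset.range t, n s i‖ ^ 2) := by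
    intro t ht
    have ht' : t ≤ τ := (Finset.mem_range.1 ht).le
    have htc : (t : ℝ) ≤ τ := by exact_mod_cast ht'
    have h1 : (N : ℝ) * (α ^ 2 * τ ^ 2 * ‖g‖ ^ 2) = ∑ _i : Fin N, α ^ 2 * τ ^ 2 * ‖g‖ ^ 2 := by
      simp
    have h2 : α ^ 2 * (τ * (L ^ 2 * drift τ x φ)) =
        ∑ i, α ^ 2 * (τ * (L ^ 2 * ∑ s ∈ Finset.range τ, ‖φ s i - avg x‖ ^ 2)) := by
      rw [drift, Finset.sum_comm]
      simp only [Finset.mul_sum]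
    rw [h1, h2, Finset.mul_sum, ← Finset.sum_add_distrib, ← Finset.sum_add_distrib,
      ← Finset.sum_add_distrib, ← Finset.sum_add_distrib, Finset.mul_sum]
    refine Finset.sum_le_sum fun i _ => ?_
    rw [h.sub_avg_eq hτ t i]
    refine (norm_sub_four_sq_le _ _ _ _ _).trans ?_
    have h3 := sum_norm_gradient_sub_sq_le (x := x) (φ := φ) hf t ht' i
    rw [norm_smul_sq, norm_smul_sq, norm_smul_sq, norm_smul_sq]
    have h4 : ((t : ℝ) / τ) ^ 2 ≤ 1 :=
      pow_le_one₀ (by positivity) ((div_le_one hτ').2 htc)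
    have h5 : (α * t) ^ 2 ≤ α ^ 2 * τ ^ 2 := by
      rw [mul_pow]
      gcongr
    have h6 := mul_le_mul_of_nonneg_left h3 (sq_nonneg α)
    have h7 := mul_le_mul_of_nonneg_right h4 (sq_nonneg ‖dualDev f α τ x y i‖)
    have h8 := mul_le_mul_of_nonneg_right h5 (sq_nonneg ‖g‖)
    linarith
  have hsum := Finset.sum_le_sum key
  rw [← Finset.mul_sum] at hsum
  simp only [Finset.sum_add_distrib, Finset.sum_const, Finset.card_range, nsmul_eq_mul,
    ← Finset.mul_sum] at hsum
  change drift τ x φ ≤ 5 * (_ + _ + _ + _ + α ^ 2 * noiseDrift τ n) at hsum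
  -- The drift reappears on the right through the gradient changes; since `10(ατL)² ≤ 1`, that
  -- contribution is at most half of it and is absorbed.
  have h9 : τ * (α ^ 2 * (τ * (L ^ 2 * drift τ x φ))) = (α * τ * L) ^ 2 * drift τ x φ := by ring
  have h10 := mul_le_mul_of_nonneg_right hθ (drift_nonneg (τ := τ) x φ)
  linarith

lemma avg_het (hN : 0 < N) (hf : ∀ i, IsLSmooth L (f i)) (p : Vec m) :
    avg (fun i => gradient (f i) p - gradient (aggregate f) p) = 0 := by
  rw [gradient_aggregate hf p]
  exact avg_centered hN _

lemma avg_dualDev (hN : 0 < N) (hf : ∀ i, IsLSmooth L (f i)) (hy : avg y = 0) :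
    avg (dualDev f α τ x y) = 0 := by
  have h := avg_add y fun i =>
    (α * τ) • (gradient (f i) (avg x) - gradient (aggregate f) (avg x))
  rw [avg_smul, avg_het hN hf, smul_zero, hy, add_zero] at h
  exact h

lemma IsRound.last_eq (h : IsRound f α τ x y φ n) (hτ : 0 < τ) (i : Fin N) :
    φ τ i = x i - α • gradDrift f τ x φ i - dualDev f α τ x y i
      - (α * τ) • gradient (aggregate f) (avg x) - α • noiseSum τ n i := by
  have hτ' : (τ : ℝ) ≠ 0 := by positivity
  have h1 := h.sub_avg_eq hτ τ i
  rw [div_self hτ', one_smul, sub_eq_iff_eq_add] at h1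
  rw [h1, gradDrift, noiseSum]
  abel

lemma IsRound.avg_last (h : IsRound f α τ x y φ n) (hN : 0 < N) (hτ : 0 < τ)
    (hf : ∀ i, IsLSmooth L (f i)) (hy : avg y = 0) :
    avg (φ τ) = avg x - α • avg (gradDrift f τ x φ)
      - (α * τ) • gradient (aggregate f) (avg x)
      - α • avg (noiseSum τ n) := by
  have h1 : φ τ = fun i => _ := funext fun i => h.last_eq hτ i
  rw [h1, avg_sub, avg_sub, avg_sub, avg_sub, avg_smul,
    avg_smul α (noiseSum τ n), avg_dualDev hN hf hy, avg_const hN, sub_zero]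

/-- Split `x̄ - x⋆` at the local iterate: smoothness of `fᵢ` handles the segment to `x̄`, strong
convexity the one to `x⋆`. Convexity of each `fᵢ` matters because gradients are taken at different
points. Half of the strong convexity is spent on replacing the local iterate by `x̄`. -/
lemma sum_inner_gradient_ge (hN : 0 < N) (hμ : 0 ≤ μ) (hf : ∀ i, IsLSmooth L (f i))
    (hc : ∀ i, StrongConvexOn Set.univ μ (f i)) (xs : Vec m) :
    N * (τ * (aggregate f (avg x) - aggregate f xs + μ / 4 * ‖avg x - xs‖ ^ 2))
        - (L / 2 + μ / 2) * drift τ x φ ≤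
      N * inner ℝ (avg (gradDrift f τ x φ) + (τ : ℝ) • gradient (aggregate f) (avg x))
        (avg x - xs) := by
  have hN' : (N : ℝ) ≠ 0 := by positivity
  have h1 : (N : ℝ) * inner ℝ (avg (gradDrift f τ x φ)
      + (τ : ℝ) • gradient (aggregate f) (avg x)) (avg x - xs)
      = ∑ t ∈ Finset.range τ, ∑ i, inner ℝ (gradient (f i) (φ t i)) (avg x - xs) := by
    have h2 : (N : ℝ) • (avg (gradDrift f τ x φ) + (τ : ℝ) • gradient (aggregate f) (avg x))
        = ∑ t ∈ Finset.range τ, ∑ i, gradient (f i) (φ t i) := by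
      rw [gradient_aggregate hf, ← avg_smul, ← avg_add, ← sum_eq_smul_avg hN, Finset.sum_comm]
      refine Finset.sum_congr rfl fun i _ => ?_
      rw [gradDrift, Finset.sum_sub_distrib, Finset.sum_const, Finset.card_range,
        ← Nat.cast_smul_eq_nsmul ℝ, sub_add_cancel]
    calc _ = inner ℝ ((N : ℝ) • (avg (gradDrift f τ x φ)
          + (τ : ℝ) • gradient (aggregate f) (avg x))) (avg x - xs) := by
            rw [real_inner_smul_left]
      _ = _ := by rw [h2, sum_inner]; simp only [sum_inner]
  have h3 : ∀ t i, f i (avg x) - f i xs + μ / 4 * ‖avg x - xs‖ ^ 2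
      - (L / 2 + μ / 2) * ‖φ t i - avg x‖ ^ 2 ≤
      inner ℝ (gradient (f i) (φ t i)) (avg x - xs) := by
    intro t i
    have a1 := (hf i).le_quadratic (φ t i) (avg x)
    have a2 := strongConvexOn_quadratic_le (hf i).differentiable (hc i) (φ t i) xs
    have a3 : inner ℝ (gradient (f i) (φ t i)) (avg x - xs)
        = inner ℝ (gradient (f i) (φ t i)) (avg x - φ t i)
          - inner ℝ (gradient (f i) (φ t i)) (xs - φ t i) := by
      rw [← inner_sub_right, sub_sub_sub_cancel_right]
    have a4 := norm_add_sq_le_of_pos one_pos (avg x - φ t i) (φ t i - xs)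
    rw [sub_add_sub_cancel] at a4
    rw [norm_sub_rev (avg x) (φ t i)] at a1 a4
    rw [norm_sub_rev xs (φ t i)] at a2
    nlinarith
  rw [h1]
  refine le_trans (le_of_eq ?_) (Finset.sum_le_sum fun t _ => Finset.sum_le_sum fun i _ => h3 t i)
  simp only [Finset.sum_sub_distrib, Finset.sum_add_distrib, Finset.sum_const, Finset.card_univ,
    Fintype.card_fin, Finset.card_range, nsmul_eq_mul, ← Finset.mul_sum, drift, aggregate]
  field_simp

end Round

/-! ### Descent of the averaged iterate -/

section Descent

variable {N m τ : ℕ} {W : Matrix (Fin N) (Fin N) ℝ} {L μ α : ℝ} {f : Fin N → Vec m → ℝ}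
  {x y : Fin N → Vec m} {φ n : ℕ → Fin N → Vec m} {xs : Vec m}

lemma norm_avg_gradDrift_sq_le (hN : 0 < N) (hf : ∀ i, IsLSmooth L (f i)) :
    N * ‖avg (gradDrift f τ x φ)‖ ^ 2 ≤ τ * (L ^ 2 * drift τ x φ) :=
  (norm_avg_sq_le hN _).trans (sum_norm_gradDrift_sq_le hf)

/-- Here `b` is the gradient drift, `g` the gradient and `s` the noise. Only `a` and `g` are fixed
before the noise is drawn, so the product of `s` with them is kept exactly, while that of `s` with
`b` goes into squares. -/
lemma norm_sub_gradient_step_sq_le {E : Type*} [NormedAddCommGroup E] [InnerProductSpace ℝ E]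
    (a b g s : E) (α t : ℝ) :
    ‖a - α • b - (α * t) • g - α • s‖ ^ 2 ≤
      ‖a‖ ^ 2 - 2 * α * inner ℝ (b + t • g) a + 2 * (α * t) ^ 2 * ‖g‖ ^ 2 + 3 * α ^ 2 * ‖b‖ ^ 2
        + 2 * α ^ 2 * ‖s‖ ^ 2 - 2 * α * inner ℝ (a - (α * t) • g) s := by
  have h0 : a - α • b - (α * t) • g - α • s = (a - α • (b + t • g)) - α • s := by
    module
  have h1 : ‖(a - α • (b + t • g)) - α • s‖ ^ 2 = ‖a‖ ^ 2 - 2 * α * inner ℝ (b + t • g) a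
      + α ^ 2 * ‖b + t • g‖ ^ 2 - 2 * α * inner ℝ (a - (α * t) • g) s
      + 2 * α ^ 2 * inner ℝ b s + α ^ 2 * ‖s‖ ^ 2 := by
    rw [norm_sub_sq_real, norm_sub_sq_real, norm_smul_sq, norm_smul_sq]
    simp only [inner_sub_left, inner_add_left, inner_smul_left, inner_smul_right, inner_add_right,
      conj_trivial, real_inner_comm b a, real_inner_comm g a]
    ring
  have h2 : ‖b + t • g‖ ^ 2 ≤ 2 * ‖b‖ ^ 2 + 2 * (t ^ 2 * ‖g‖ ^ 2) := by
    have := norm_add_sq_le_of_pos one_pos b (t • g)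
    rw [norm_smul_sq] at this
    linarith
  have h3 : 2 * inner ℝ b s ≤ ‖b‖ ^ 2 + ‖s‖ ^ 2 := by
    have := norm_sub_sq_real b s
    nlinarith [sq_nonneg ‖b - s‖]
  rw [h0, h1]
  nlinarith [mul_le_mul_of_nonneg_left h2 (sq_nonneg α),
    mul_le_mul_of_nonneg_left h3 (sq_nonneg α)]

lemma IsRound.norm_avg_last_sub_sq_le (h : IsRound f α τ x y φ n) (hN : 0 < N) (hτ : 0 < τ)
    (hL : 0 < L) (hα : 0 < α) (hμ : 0 ≤ μ) (hμL : μ ≤ L) (hf : ∀ i, IsLSmooth L (f i))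
    (hc : ∀ i, StrongConvexOn Set.univ μ (f i)) (hmin : ∀ p, aggregate f xs ≤ aggregate f p)
    (hy : avg y = 0) :
    ‖avg (φ τ) - xs‖ ^ 2 ≤ (1 - α * τ * μ / 2) * ‖avg x - xs‖ ^ 2
      - (2 - 4 * (α * τ * L)) * (α * τ * (aggregate f (avg x) - aggregate f xs))
      + (2 + 3 * (α * τ * L)) * (α * L * drift τ x φ / N)
      + 2 * α ^ 2 * ‖avg (noiseSum τ n)‖ ^ 2
      - 2 * α * inner ℝ (avg x - xs - (α * τ) • gradient (aggregate f) (avg x))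
          (avg (noiseSum τ n)) := by
  have hN' : (0 : ℝ) < N := by exact_mod_cast hN
  have h1 : avg (φ τ) - xs = (avg x - xs) - α • avg (gradDrift f τ x φ)
      - (α * τ) • gradient (aggregate f) (avg x) - α • avg (noiseSum τ n) := by
    rw [h.avg_last hN hτ hf hy]
    abel
  have h2 := norm_sub_gradient_step_sq_le (avg x - xs) (avg (gradDrift f τ x φ))
    (gradient (aggregate f) (avg x)) (avg (noiseSum τ n)) α τ
  rw [← h1] at h2
  have h3 := sum_inner_gradient_ge (τ := τ) (x := x) (φ := φ) hN hμ hf hc xs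
  have h4 := norm_avg_gradDrift_sq_le (τ := τ) (x := x) (φ := φ) hN hf
  have h5 := (isLSmooth_aggregate hN hf).norm_gradient_sq_le hL hmin (avg x)
  set D := drift τ x φ
  have hD : 0 ≤ D := drift_nonneg x φ
  set F := aggregate f (avg x) - aggregate f xs
  set G := avg (gradDrift f τ x φ)
  set g := gradient (aggregate f) (avg x)
  set V := ‖avg x - xs‖ ^ 2
  have h6 : τ * (F + μ / 4 * V) - L * (D / N) ≤ inner ℝ (G + (τ : ℝ) • g) (avg x - xs) := by
    have e1 : (L / 2 + μ / 2) * D ≤ L * D := mul_le_mul_of_nonneg_right (by linarith) hD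
    have e2 : N * (L * (D / N)) = L * D := by field_simp
    exact le_of_mul_le_mul_left (by linarith) hN'
  have h7 : ‖G‖ ^ 2 ≤ τ * (L ^ 2 * (D / N)) := by
    have e2 : N * (τ * (L ^ 2 * (D / N))) = τ * (L ^ 2 * D) := by field_simp
    exact le_of_mul_le_mul_left (by linarith) hN'
  have h8 := mul_le_mul_of_nonneg_left h6 (by positivity : 0 ≤ 2 * α)
  have h9 := mul_le_mul_of_nonneg_left h7 (by positivity : 0 ≤ 3 * α ^ 2)
  have h10 := mul_le_mul_of_nonneg_left h5 (by positivity : 0 ≤ 2 * (α * τ) ^ 2)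
  have e3 : α * L * D / N = α * L * (D / N) := by ring
  rw [e3]
  linarith

/-- The movement of the average controls how far the target of the dual variable moves in a round.
-/
lemma IsRound.norm_avg_last_sub_avg_sq_le (h : IsRound f α τ x y φ n) (hN : 0 < N) (hτ : 0 < τ)
    (hL : 0 < L) (hf : ∀ i, IsLSmooth L (f i))
    (hmin : ∀ p, aggregate f xs ≤ aggregate f p) (hy : avg y = 0) :
    ‖avg (φ τ) - avg x‖ ^ 2 ≤
      8 * (α * τ * L) * (α * τ * (aggregate f (avg x) - aggregate f xs))
        + 4 * (α * τ * L) * (α * L * drift τ x φ / N)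
        + 2 * α ^ 2 * ‖avg (noiseSum τ n)‖ ^ 2 := by
  have hN' : (0 : ℝ) < N := by exact_mod_cast hN
  have h1 : avg (φ τ) - avg x = -(α • (avg (gradDrift f τ x φ)
      + (τ : ℝ) • gradient (aggregate f) (avg x)) + α • avg (noiseSum τ n)) := by
    rw [h.avg_last hN hτ hf hy]
    module
  have h2 := norm_add_sq_le_of_pos one_pos (α • (avg (gradDrift f τ x φ)
      + (τ : ℝ) • gradient (aggregate f) (avg x))) (α • avg (noiseSum τ n))
  have h3 := norm_add_sq_le_of_pos one_pos (avg (gradDrift f τ x φ))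
      ((τ : ℝ) • gradient (aggregate f) (avg x))
  rw [norm_smul_sq] at h3
  rw [norm_smul_sq, norm_smul_sq] at h2
  have h4 := norm_avg_gradDrift_sq_le (τ := τ) (x := x) (φ := φ) hN hf
  have h5 := (isLSmooth_aggregate hN hf).norm_gradient_sq_le hL hmin (avg x)
  rw [h1, norm_neg]
  set D := drift τ x φ
  have h7 : ‖avg (gradDrift f τ x φ)‖ ^ 2 ≤ τ * (L ^ 2 * (D / N)) := by
    have e2 : N * (τ * (L ^ 2 * (D / N))) = τ * (L ^ 2 * D) := by field_simp
    exact le_of_mul_le_mul_left (by linarith) hN'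
  have h8 := mul_le_mul_of_nonneg_left h3 (by positivity : 0 ≤ 2 * α ^ 2)
  have h9 := mul_le_mul_of_nonneg_left h7 (by positivity : 0 ≤ 4 * α ^ 2)
  have h10 := mul_le_mul_of_nonneg_left h5 (by positivity : 0 ≤ 4 * α ^ 2 * τ ^ 2)
  have e3 : α * L * D / N = α * L * (D / N) := by ring
  rw [e3]
  linarith

end Descent

/-! ### Recursion for the consensus energy -/

section EnergyStep

variable {N m τ : ℕ} {W : Matrix (Fin N) (Fin N) ℝ} {L μ α : ℝ} {f : Fin N → Vec m → ℝ}
  {x y : Fin N → Vec m} {φ n : ℕ → Fin N → Vec m} {xs : Vec m}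

/-- The consensus energy of the state `(x, y)`. -/
noncomputable def energy (hW : W.IsHermitian) (f : Fin N → Vec m → ℝ) (α : ℝ) (τ : ℕ)
    (x y : Fin N → Vec m) : ℝ :=
  primalEnergy hW (fun i => x i - avg x) + dualEnergy hW (dualDev f α τ x y)

lemma norm_sub_sub_sq_le {E : Type*} [NormedAddCommGroup E] [InnerProductSpace ℝ E]
    {ε : ℝ} (hε : 0 < ε) (a d s : E) :
    ‖a - d - s‖ ^ 2 ≤ (1 + ε) * ‖a‖ ^ 2 + (2 + 1 / ε) * ‖d‖ ^ 2 + 2 * ‖s‖ ^ 2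
      - 2 * inner ℝ a s := by
  have h1 := norm_add_sq_le_of_pos hε a (-d)
  rw [← sub_eq_add_neg, norm_neg] at h1
  have h2 : 2 * inner ℝ d s ≤ ‖d‖ ^ 2 + ‖s‖ ^ 2 := by
    have := norm_sub_sq_real d s
    nlinarith [sq_nonneg ‖d - s‖]
  rw [norm_sub_sq_real (a - d) s, inner_sub_left]
  linarith

lemma IsRound.energy_next_le (h : IsRound f α τ x y φ n) (hW : IsWeightMatrix W)
    (hl : mixingRate W < 1) (hN : 0 < N) (hτ : 0 < τ)
    (hf : ∀ i, IsLSmooth L (f i)) (hy : avg y = 0) {ε : ℝ} (hε : 0 < ε) :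
    energy hW.posDef.isHermitian f α τ (mix W (φ τ)) (fun i => y i + φ τ i - mix W (φ τ) i) ≤
      (1 + ε) * ((1 + ε) * (mixingRate W * energy hW.posDef.isHermitian f α τ x y)
        + (2 + 1 / ε) * (α ^ 2 * (τ * (L ^ 2 * drift τ x φ)))
        + 2 * (α ^ 2 * ∑ i, ‖noiseSum τ n i‖ ^ 2)
        - 2 * (α * ∑ i, inner ℝ (x i - avg x) (noiseSum τ n i)))
      + (1 + 1 / ε) * ((α * τ) ^ 2 * (N * (L ^ 2 * ‖avg (φ τ) - avg x‖ ^ 2))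
          / (1 - mixingRate W)) := by
  set G := gradDrift f τ x φ with hG
  set S := noiseSum τ n with hS
  set z := dualDev f α τ x y with hz
  set a : Fin N → Vec m := fun i => x i - avg x with ha
  set d : Fin N → Vec m := fun i => α • (G i - avg G) with hd
  set s : Fin N → Vec m := fun i => α • (S i - avg S) with hs
  set v : Fin N → Vec m := fun i => a i - d i - s i with hv
  set H : Vec m → Fin N → Vec m := fun p i => gradient (f i) p - gradient (aggregate f) p with hH
  set η : Fin N → Vec m := fun i => (α * τ) • (H (avg (φ τ)) i - H (avg x) i) with hη
  have ha0 : avg a = 0 := avg_centered hN x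
  have hv0 : avg v = 0 := by
    rw [hv, avg_sub, avg_sub a d, ha0, hd, hs, avg_smul, avg_smul, avg_centered hN,
      avg_centered hN]
    simp
  have hz0 : avg z = 0 := avg_dualDev hN hf hy
  have hη0 : avg η = 0 := by
    rw [hη, avg_smul, avg_sub, hH, avg_het hN hf, avg_het hN hf, sub_zero, smul_zero]
  have havg : avg (mix W (φ τ)) = avg (φ τ) := avg_mix hW _
  have hlast : ∀ i, φ τ i - avg (φ τ) = v i - z i := by
    intro i
    rw [h.avg_last hN hτ hf hy, h.last_eq hτ i]
    simp only [hv, ha, hd, hs, ← hS, ← hG, ← hz]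
    module
  have hmix : ∀ i, mix W (φ τ) i - avg (φ τ) = mix W (fun j => v j - z j) i := by
    intro i
    have e : (fun j => v j - z j) = fun j => φ τ j - avg (φ τ) := funext fun j => (hlast j).symm
    rw [e, mix_sub, mix_const hW]
  have hx' : (fun i => mix W (φ τ) i - avg (mix W (φ τ))) = mix W (fun i => v i - z i) := by
    rw [havg]; exact funext hmix
  -- Since `φ - x̄⁺ = v - z`, the new deviation is `z + (1 - W)(v - z) + η = Wz + (1 - W)v + η`.
  have hy' : dualDev f α τ (mix W (φ τ)) (fun i => y i + φ τ i - mix W (φ τ) i) =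
      fun i => (mix W z i + (v i - mix W v i)) + η i := by
    funext i
    have e1 := hlast i
    have e2 := hmix i
    rw [mix_sub] at e2
    have e3 : y i = z i - (α * τ) • H (avg x) i := by
      simp only [hz, dualDev, hH, add_sub_cancel_right]
    have e4 : φ τ i - mix W (φ τ) i = (v i - z i) - (mix W v i - mix W z i) := by
      rw [← e1, ← e2]; abel
    rw [dualDev, havg, add_sub_assoc, e4, e3]
    simp only [hη, hH]
    module
  have hstep := energy_step_le hW hl hv0 hz0 hη0 hε
  rw [energy, hx', hy']
  refine hstep.trans ?_
  have hl' : 0 < 1 - mixingRate W := by linarith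
  have hηle : ∑ i, ‖η i‖ ^ 2 ≤ (α * τ) ^ 2 * (N * (L ^ 2 * ‖avg (φ τ) - avg x‖ ^ 2)) := by
    simp only [hη, norm_smul_sq, ← Finset.mul_sum]
    refine mul_le_mul_of_nonneg_left ?_ (sq_nonneg _)
    -- The change of heterogeneity is the centred change of the local gradients, and centring does
    -- not increase the sum of squares.
    have e1 := consensusError_le hN fun i =>
      gradient (f i) (avg (φ τ)) - gradient (f i) (avg x)
    have e2 : ∀ i, H (avg (φ τ)) i - H (avg x) i = (gradient (f i) (avg (φ τ)) -
        gradient (f i) (avg x)) - avg fun i =>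
          gradient (f i) (avg (φ τ)) - gradient (f i) (avg x) := by
      intro i
      simp only [hH, avg_sub, gradient_aggregate hf]
      abel
    simp only [e2]
    refine e1.trans ?_
    refine (Finset.sum_le_sum fun i _ => pow_le_pow_left₀ (norm_nonneg _)
      ((hf i).gradient_lipschitz (avg (φ τ)) (avg x)) 2).trans (le_of_eq ?_)
    simp [mul_pow]
  have hvle : ∑ i, ‖v i‖ ^ 2 ≤ (1 + ε) * ∑ i, ‖a i‖ ^ 2
      + (2 + 1 / ε) * (α ^ 2 * (τ * (L ^ 2 * drift τ x φ)))
      + 2 * (α ^ 2 * ∑ i, ‖S i‖ ^ 2) - 2 * (α * ∑ i, inner ℝ (a i) (S i)) := by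
    have e1 : ∑ i, ‖v i‖ ^ 2 ≤ (1 + ε) * ∑ i, ‖a i‖ ^ 2 + (2 + 1 / ε) * ∑ i, ‖d i‖ ^ 2
        + 2 * ∑ i, ‖s i‖ ^ 2 - 2 * ∑ i, inner ℝ (a i) (s i) := by
      simp only [Finset.mul_sum, ← Finset.sum_add_distrib, ← Finset.sum_sub_distrib]
      exact Finset.sum_le_sum fun i _ => norm_sub_sub_sq_le hε _ _ _
    have e2 : ∑ i, ‖d i‖ ^ 2 ≤ α ^ 2 * (τ * (L ^ 2 * drift τ x φ)) := by
      simp only [hd, norm_smul_sq, ← Finset.mul_sum]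
      exact mul_le_mul_of_nonneg_left ((consensusError_le hN G).trans
        (sum_norm_gradDrift_sq_le hf)) (sq_nonneg _)
    have e3 : ∑ i, ‖s i‖ ^ 2 ≤ α ^ 2 * ∑ i, ‖S i‖ ^ 2 := by
      simp only [hs, norm_smul_sq, ← Finset.mul_sum]
      exact mul_le_mul_of_nonneg_left (consensusError_le hN S) (sq_nonneg _)
    have e4 : ∑ i, inner ℝ (a i) (s i) = α * ∑ i, inner ℝ (a i) (S i) := by
      rw [← sum_inner_centered hN ha0 S, Finset.mul_sum]
      simp only [hs, real_inner_smul_right]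
    have e5 : (2 + 1 / ε) * ∑ i, ‖d i‖ ^ 2 ≤
        (2 + 1 / ε) * (α ^ 2 * (τ * (L ^ 2 * drift τ x φ))) :=
      mul_le_mul_of_nonneg_left e2 (by positivity)
    linarith
  have hale := sum_norm_sq_le_primalEnergy hW hl ha0
  have hdual : 0 ≤ dualEnergy hW.posDef.isHermitian z :=
    (Finset.sum_nonneg fun _ _ => sq_nonneg _).trans (sum_norm_sq_le_dualEnergy hW hl hz0)
  have hlam : 0 ≤ mixingRate W := mixingRate_nonneg
  have h1 : (1 + 1 / ε) * ((∑ i, ‖η i‖ ^ 2) / (1 - mixingRate W)) ≤ (1 + 1 / ε) *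
      ((α * τ) ^ 2 * (N * (L ^ 2 * ‖avg (φ τ) - avg x‖ ^ 2)) / (1 - mixingRate W)) :=
    mul_le_mul_of_nonneg_left (div_le_div_of_nonneg_right hηle hl'.le) (by positivity)
  have h2 : ∑ i, ‖v i‖ ^ 2 + mixingRate W * dualEnergy hW.posDef.isHermitian z ≤
      (1 + ε) * (mixingRate W * energy hW.posDef.isHermitian f α τ x y)
        + (2 + 1 / ε) * (α ^ 2 * (τ * (L ^ 2 * drift τ x φ)))
        + 2 * (α ^ 2 * ∑ i, ‖S i‖ ^ 2) - 2 * (α * ∑ i, inner ℝ (a i) (S i)) := by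
    have e1 := mul_le_mul_of_nonneg_left hale (by positivity : 0 ≤ 1 + ε)
    have e2 : 0 ≤ ε * (mixingRate W * dualEnergy hW.posDef.isHermitian z) := by positivity
    rw [energy, ← ha, ← hz]
    linarith
  exact add_le_add (mul_le_mul_of_nonneg_left h2 (by positivity)) h1

lemma energy_nonneg (hW : IsWeightMatrix W) (hl : mixingRate W < 1) (hN : 0 < N)
    (hf : ∀ i, IsLSmooth L (f i)) (hy : avg y = 0) :
    0 ≤ energy hW.posDef.isHermitian f α τ x y :=
  add_nonneg (primalEnergy_nonneg hW _) ((Finset.sum_nonneg fun _ _ => sq_nonneg _).trans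
    (sum_norm_sq_le_dualEnergy hW hl (avg_dualDev hN hf hy)))

lemma sum_norm_sq_le_energy (hW : IsWeightMatrix W) (hl : mixingRate W < 1) (hN : 0 < N)
    (hf : ∀ i, IsLSmooth L (f i)) (hy : avg y = 0) :
    ∑ i, ‖x i - avg x‖ ^ 2 + ∑ i, ‖dualDev f α τ x y i‖ ^ 2 ≤
      energy hW.posDef.isHermitian f α τ x y := by
  have h1 := sum_norm_sq_le_primalEnergy hW hl (avg_centered hN x)
  have h2 := sum_norm_sq_le_dualEnergy hW hl (avg_dualDev (τ := τ) (α := α) (x := x) hN hf hy)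
  have h3 := primalEnergy_nonneg hW fun i => x i - avg x
  rw [energy]
  nlinarith

/-- The Lyapunov function of the state `(x, y)`. -/
noncomputable def lyapunov (hW : W.IsHermitian) (f : Fin N → Vec m → ℝ) (L α : ℝ) (τ : ℕ)
    (xs : Vec m) (x y : Fin N → Vec m) : ℝ :=
  ‖avg x - xs‖ ^ 2 + 160 * (α * τ * L / (1 - mixingRate W)) * (energy hW f α τ x y / N)

/-- Dimensionless form of the energy recursion per node: `θ = ατL`, `γ = 1 - λ`, `ρ = θ/γ`, `p` is
`ατ` times the gap, `Δ = αL/N` times the drift, `s` and `sb` are squared noise per node and of the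
average, `l` is the linear noise. The Young parameter is `γ/4`, so that `(1 + γ/4)²(1 - γ) ≤ 1 -
γ/2`. The powers of `1/γ` this costs turn `θ` into `ρ`. -/
lemma energy_recursion_arith {θ γ ρ e e' p Δ l s sb : ℝ} (hγ : 0 < γ) (hγ1 : γ ≤ 1)
    (hθγ : θ = ρ * γ) (hρ0 : 0 ≤ ρ) (hρc : ρ ≤ 1 / 100) (he : 0 ≤ e)
    (hp : 0 ≤ p) (hΔ : 0 ≤ Δ) (hsb : 0 ≤ sb) (hs : sb ≤ s)
    (he' : e' ≤ (1 + γ / 4) * ((1 + γ / 4) * ((1 - γ) * e) + (2 + 1 / (γ / 4)) * (θ * Δ)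
        + 2 * s - 2 * l)
      + (1 + 1 / (γ / 4)) * (θ ^ 2 * (8 * θ * p + 4 * θ * Δ + 2 * sb) / γ)) :
    e' ≤ (1 - γ / 2) * e + 8 * (ρ * Δ) + 3 * s + 1 / 100 * p - (1 + γ / 4) * (2 * l) := by
  have hθ : 0 ≤ θ := by rw [hθγ]; positivity
  have hθρ : θ ≤ 1 / 100 := by
    rw [hθγ]; exact (mul_le_of_le_one_right hρ0 hγ1).trans hρc
  have i1 : (1 + γ / 4) * (1 + γ / 4) * (1 - γ) ≤ 1 - γ / 2 := by nlinarith [mul_pos hγ hγ]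
  have i2 : (1 + γ / 4) * ((2 + 1 / (γ / 4)) * (θ * Δ)) ≤ 15 / 2 * (ρ * Δ) := by
    have e1 : (1 + γ / 4) * ((2 + 1 / (γ / 4)) * (θ * Δ))
        = (1 + γ / 4) * (2 * γ + 4) * (ρ * Δ) := by
      rw [hθγ]; field_simp
    rw [e1]
    exact mul_le_mul_of_nonneg_right (by nlinarith) (by positivity)
  have i3 : (1 + 1 / (γ / 4)) * (θ ^ 2 * (8 * θ * p + 4 * θ * Δ + 2 * sb) / γ) ≤
      5 * (ρ ^ 2 * (8 * θ * p + 4 * θ * Δ + 2 * sb)) := by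
    have e1 : (1 + 1 / (γ / 4)) * (θ ^ 2 * (8 * θ * p + 4 * θ * Δ + 2 * sb) / γ)
        = (γ + 4) * (ρ ^ 2 * (8 * θ * p + 4 * θ * Δ + 2 * sb)) := by
      rw [hθγ]; field_simp
    rw [e1]
    exact mul_le_mul_of_nonneg_right (by linarith) (by positivity)
  have hs0 : 0 ≤ s := hsb.trans hs
  have hρ2 : ρ ^ 2 ≤ 1 / 100 * ρ := by
    rw [sq]; exact mul_le_mul_of_nonneg_right hρc hρ0
  have hρ3 : ρ ^ 2 ≤ 1 / 10000 := by linarith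
  have i4 : (1 + γ / 4) * (2 * s) ≤ 5 / 2 * s := by
    have := mul_le_mul_of_nonneg_right hγ1 hs0
    linarith
  have i5 := mul_le_mul_of_nonneg_right i1 he
  have i6 : ρ ^ 2 * (8 * θ * p) ≤ 1 / 10000 * (8 * (1 / 100) * p) :=
    mul_le_mul hρ3 (mul_le_mul_of_nonneg_right (by linarith) hp) (by positivity) (by norm_num)
  have i7 : ρ ^ 2 * (4 * θ * Δ) ≤ 1 / 100 * ρ * (4 * (1 / 100) * Δ) :=
    mul_le_mul hρ2 (mul_le_mul_of_nonneg_right (by linarith) hΔ) (by positivity) (by positivity)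
  have i8 : ρ ^ 2 * (2 * sb) ≤ 1 / 10000 * (2 * s) :=
    mul_le_mul hρ3 (by linarith) (by positivity) (by norm_num)
  have i9 : 0 ≤ ρ * Δ := by positivity
  linarith

/-- The weight `160ρ` turns the contraction of the energy into a gain `80ργe`. At most `40ργe` is
needed for the factor `1 - w/4`, and the drift terms cost less than `22ργe`, since `Δ` carries a
total coefficient below `2.2` and contributes `10θe = 10ργe`. For the same reason `40q` covers the
noise in the drift, and of the `2p` gained by descent at least `p` survives. -/
lemma lyapunov_arith {θ γ ρ q V V' e e' p Δ l₁ l₂ s sb w : ℝ} (hγ : 0 < γ) (hγ1 : γ ≤ 1)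
    (hθγ : θ = ρ * γ) (hρ0 : 0 ≤ ρ) (hρc : ρ ≤ 1 / 100) (hV : 0 ≤ V) (he : 0 ≤ e)
    (hp : 0 ≤ p) (hΔ : 0 ≤ Δ) (hw0 : 0 ≤ w) (hw : w ≤ θ)
    (hV' : V' ≤ (1 - w / 2) * V - (2 - 4 * θ) * p + (2 + 3 * θ) * Δ + 2 * sb - l₁)
    (he' : e' ≤ (1 - γ / 2) * e + 8 * (ρ * Δ) + 3 * s + 1 / 100 * p - l₂)
    (hΔ' : Δ ≤ 10 * θ * e + 20 * θ ^ 2 * p + 10 * q) :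
    V' + 160 * ρ * e' ≤ (1 - w / 4) * (V + 160 * ρ * e) - p
      + (2 * sb + 480 * ρ * s + 40 * q) - l₁ - 160 * ρ * l₂ := by
  have hθ : 0 ≤ θ := by rw [hθγ]; positivity
  have hθρ : θ ≤ 1 / 100 := by
    rw [hθγ]; exact (mul_le_of_le_one_right hρ0 hγ1).trans hρc
  have j1 := mul_le_mul_of_nonneg_left he' (by positivity : 0 ≤ 160 * ρ)
  have j2 : ρ * ρ * Δ ≤ 1 / 100 * (1 / 100) * Δ :=
    mul_le_mul_of_nonneg_right (mul_le_mul hρc hρc hρ0 (by norm_num)) hΔ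
  have j3 : θ * Δ ≤ 1 / 100 * Δ := mul_le_mul_of_nonneg_right hθρ hΔ
  have j4 : ρ * p ≤ 1 / 100 * p := mul_le_mul_of_nonneg_right hρc hp
  have j5 : θ * p ≤ 1 / 100 * p := mul_le_mul_of_nonneg_right hθρ hp
  have j6 : θ ^ 2 * p ≤ 1 / 100 * (1 / 100) * p := by
    rw [sq]
    exact mul_le_mul_of_nonneg_right (mul_le_mul hθρ hθρ hθ (by norm_num)) hp
  have j7 : θ * e = ρ * γ * e := by rw [hθγ]
  have j8 : 0 ≤ w * V := mul_nonneg hw0 hV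
  have j9 : w * (ρ * e) ≤ γ * (ρ * e) := by
    refine mul_le_mul_of_nonneg_right (hw.trans ?_) (by positivity)
    rw [hθγ]
    exact mul_le_of_le_one_left hγ.le (by linarith)
  have j10 : 0 ≤ ρ * γ * e := by positivity
  linarith

end EnergyStep

/-! ### Pathwise Lyapunov inequality and initial value -/

section Lyapunov

variable {N m τ : ℕ} {W : Matrix (Fin N) (Fin N) ℝ} {L μ α : ℝ} {f : Fin N → Vec m → ℝ}
  {x y : Fin N → Vec m} {φ n : ℕ → Fin N → Vec m} {xs : Vec m}

/-- The weights with which the accumulated gradient errors enter the Lyapunov recursion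
linearly. -/
noncomputable def noiseWeight (W : Matrix (Fin N) (Fin N) ℝ) (f : Fin N → Vec m → ℝ) (L α : ℝ)
    (τ : ℕ) (xs : Vec m) (x : Fin N → Vec m) : Fin N → Vec m :=
  fun i => -((2 * α / N) • (avg x - xs - (α * τ) • gradient (aggregate f) (avg x)))
    - (320 * (α * τ * L / (1 - mixingRate W)) * (1 + (1 - mixingRate W) / 4) * α / N) •
      (x i - avg x)

/-- Collects the linear noise of the descent step and of the energy step, the latter weighted by
`160ρ`, into one pairing whose weights depend only on the state at the start of the round. -/
lemma sum_inner_noiseWeight (S : Fin N → Vec m) :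
    ∑ i, inner ℝ (noiseWeight W f L α τ xs x i) (S i) =
      -(2 * α * inner ℝ (avg x - xs - (α * τ) • gradient (aggregate f) (avg x)) (avg S))
      - 160 * (α * τ * L / (1 - mixingRate W)) * ((1 + (1 - mixingRate W) / 4) *
        (2 * (α * (∑ i, inner ℝ (x i - avg x) (S i)) / N))) := by
  have h : ∀ u : Vec m, inner ℝ u (avg S) = (N : ℝ)⁻¹ * ∑ i, inner ℝ u (S i) := fun u => by
    rw [avg, real_inner_smul_right, inner_sum]
  rw [h]
  simp only [noiseWeight, inner_sub_left, inner_neg_left, real_inner_smul_left,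
    Finset.sum_sub_distrib, Finset.sum_neg_distrib, ← Finset.mul_sum]
  ring

lemma IsRound.lyapunov_next_le (h : IsRound f α τ x y φ n) (hW : IsWeightMatrix W)
    (hl : mixingRate W < 1) (hN : 0 < N) (hτ : 0 < τ) (hL : 0 < L) (hα : 0 < α) (hμ : 0 ≤ μ)
    (hμL : μ ≤ L) (hf : ∀ i, IsLSmooth L (f i)) (hc : ∀ i, StrongConvexOn Set.univ μ (f i))
    (hmin : ∀ p, aggregate f xs ≤ aggregate f p) (hy : avg y = 0)
    (hstep : α * τ * L / (1 - mixingRate W) ≤ 1 / 100) :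
    lyapunov hW.posDef.isHermitian f L α τ xs (mix W (φ τ))
        (fun i => y i + φ τ i - mix W (φ τ) i) ≤
      (1 - α * τ * μ / 4) * lyapunov hW.posDef.isHermitian f L α τ xs x y
      - α * τ * (aggregate f (avg x) - aggregate f xs)
      + (2 * (α ^ 2 * ‖avg (noiseSum τ n)‖ ^ 2)
        + 480 * (α * τ * L / (1 - mixingRate W)) * (α ^ 2 * (∑ i, ‖noiseSum τ n i‖ ^ 2) / N)
        + 40 * (α ^ 3 * L * noiseDrift τ n / N))
      + ∑ i, inner ℝ (noiseWeight W f L α τ xs x i) (noiseSum τ n i) := by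
  have hN' : (0 : ℝ) < N := by exact_mod_cast hN
  have hτ' : (0 : ℝ) < τ := by exact_mod_cast hτ
  have hγ : 0 < 1 - mixingRate W := by linarith
  have hγ1 : 1 - mixingRate W ≤ 1 := by linarith [mixingRate_nonneg (W := W)]
  have hρ0 : 0 ≤ α * τ * L / (1 - mixingRate W) := by positivity
  have hθγ : α * τ * L = α * τ * L / (1 - mixingRate W) * (1 - mixingRate W) := by
    field_simp
  have hθ : α * τ * L ≤ 1 / 100 := by
    rw [hθγ]; exact (mul_le_of_le_one_right hρ0 hγ1).trans hstep
  have hθ0 : 0 ≤ α * τ * L := by positivity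
  have hD : 0 ≤ drift τ x φ := drift_nonneg x φ
  have hF : 0 ≤ aggregate f (avg x) - aggregate f xs := sub_nonneg.2 (hmin _)
  have hE := energy_nonneg (τ := τ) (α := α) (x := x) hW hl hN hf hy
  have hdrift := h.drift_le hτ hf (by nlinarith)
  have hEE := sum_norm_sq_le_energy (τ := τ) (α := α) (x := x) hW hl hN hf hy
  have hgrad := (isLSmooth_aggregate hN hf).norm_gradient_sq_le hL hmin (avg x)
  have hV' := h.norm_avg_last_sub_sq_le hN hτ hL hα hμ hμL hf hc hmin hy
  have hmove := h.norm_avg_last_sub_avg_sq_le hN hτ hL hf hmin hy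
  -- The choice `ε = (1 - λ)/4` spends half of the spectral gap on Young's inequality.
  have hE' := h.energy_next_le hW hl hN hτ hf hy (ε := (1 - mixingRate W) / 4) (by positivity)
  have havg : avg (mix W (φ τ)) = avg (φ τ) := avg_mix hW _
  have hS := norm_avg_sq_le hN (noiseSum τ n)
  rw [sum_inner_noiseWeight]
  unfold lyapunov
  rw [havg]
  set E' := energy hW.posDef.isHermitian f α τ (mix W (φ τ))
    (fun i => y i + φ τ i - mix W (φ τ) i)
  set E := energy hW.posDef.isHermitian f α τ x y
  set D := drift τ x φ
  set Q := noiseDrift τ n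
  set S := noiseSum τ n
  set F := aggregate f (avg x) - aggregate f xs
  set l := ∑ i, inner ℝ (x i - avg x) (S i)
  set M := ‖avg (φ τ) - avg x‖ ^ 2
  have hΔ' : α * L * D / N ≤ 10 * (α * τ * L) * (E / N) + 20 * (α * τ * L) ^ 2 * (α * τ * F)
      + 10 * (α ^ 3 * L * Q / N) := by
    have h1 : D ≤ 10 * (τ * E + τ * (N * (α ^ 2 * τ ^ 2 * (2 * L * F))) + α ^ 2 * Q) := by
      refine hdrift.trans ?_
      gcongr
    have h2 : α * L * D / N ≤
        α * L * (10 * (τ * E + τ * (N * (α ^ 2 * τ ^ 2 * (2 * L * F))) + α ^ 2 * Q)) / N := by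
      gcongr
    refine h2.trans (le_of_eq ?_)
    field_simp
    ring
  have hs : α ^ 2 * ‖avg S‖ ^ 2 ≤ α ^ 2 * (∑ i, ‖S i‖ ^ 2) / N := by
    rw [mul_div_assoc]
    refine mul_le_mul_of_nonneg_left ?_ (sq_nonneg _)
    rw [le_div_iff₀ hN']
    linarith
  have he' := energy_recursion_arith (e := E / N) (e' := E' / N) (p := α * τ * F)
    (Δ := α * L * D / N) (l := α * l / N) (s := α ^ 2 * (∑ i, ‖S i‖ ^ 2) / N)
    (sb := α ^ 2 * ‖avg S‖ ^ 2) hγ hγ1 hθγ hρ0 hstep (by positivity) (by positivity)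
    (by positivity) (by positivity) hs (by
      have h1 : (α * τ) ^ 2 * (N * (L ^ 2 * M)) / (1 - mixingRate W) ≤
          (α * τ) ^ 2 * (N * (L ^ 2 * (8 * (α * τ * L) * (α * τ * F)
            + 4 * (α * τ * L) * (α * L * D / N) + 2 * α ^ 2 * ‖avg S‖ ^ 2)))
            / (1 - mixingRate W) := by
        gcongr
      have h2 := hE'.trans (add_le_add_right (mul_le_mul_of_nonneg_left h1
        (by positivity : 0 ≤ 1 + 1 / ((1 - mixingRate W) / 4))) _)
      refine (div_le_div_of_nonneg_right h2 hN'.le).trans (le_of_eq ?_)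
      rw [sub_sub_cancel]
      field_simp)
  have hw : α * τ * μ ≤ α * τ * L := by gcongr
  have hfin := lyapunov_arith (V := ‖avg x - xs‖ ^ 2) (V' := ‖avg (φ τ) - xs‖ ^ 2)
    (sb := α ^ 2 * ‖avg S‖ ^ 2) (q := α ^ 3 * L * Q / N)
    hγ hγ1 hθγ hρ0 hstep (by positivity) (by positivity)
    (by positivity) (by positivity) (by positivity) hw (by
      refine hV'.trans (le_of_eq ?_)
      rw [← mul_assoc 2 (α ^ 2)]) he' hΔ'
  linarith

/-- The constant is `480 = 160 · 3`: the consensus error enters once through the primal energy and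
at most twice through the dual one, using that the smallest eigenvalue is at most one. -/
lemma lyapunov_zero_le (hW : IsWeightMatrix W) (hl : mixingRate W < 1) (hN : 0 < N)
    (hL : 0 ≤ L) (hα : 0 ≤ α) (hf : ∀ i, IsLSmooth L (f i))
    (hy : (y = fun i => x i - mix W x i) ∨ y = 0) :
    lyapunov hW.posDef.isHermitian f L α τ xs x y ≤ ‖avg x - xs‖ ^ 2
      + 480 * (α * τ * L / (1 - mixingRate W)) *
        (α ^ 2 * τ ^ 2 * heterogeneity f (avg x) / (1 - mixingRate W)
          + consensusError x / (minEigenvalue W * N)) := by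
  have hN' : (0 : ℝ) < N := by exact_mod_cast hN
  have hγ : 0 < 1 - mixingRate W := by linarith
  have hmpos := minEigenvalue_pos hN hW
  set b : Fin N → Vec m := fun i =>
    (α * τ) • (gradient (f i) (avg x) - gradient (aggregate f) (avg x)) with hb
  have hb0 : avg b = 0 := by rw [hb, avg_smul, avg_het hN hf, smul_zero]
  have hbsum : ∑ i, ‖b i‖ ^ 2 = N * (α ^ 2 * τ ^ 2 * heterogeneity f (avg x)) := by
    simp only [hb, norm_smul_sq, ← Finset.mul_sum, heterogeneity]
    field_simp
  have hcons : 0 ≤ consensusError x := consensusError_nonneg x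
  have hcons_le : consensusError x ≤ consensusError x / minEigenvalue W := by
    rw [le_div_iff₀ hmpos]
    exact mul_le_of_le_one_right hcons (minEigenvalue_le_one hN hW hl)
  have hprimal : primalEnergy hW.posDef.isHermitian (fun i => x i - avg x) ≤
      consensusError x / minEigenvalue W := primalEnergy_le hN hW _
  have hdual : dualEnergy hW.posDef.isHermitian (dualDev f α τ x y) ≤
      2 * consensusError x + 2 * ((∑ i, ‖b i‖ ^ 2) / (1 - mixingRate W)) := by
    rcases hy with rfl | rfl
    · have h1 := dualEnergy_sub_mix_add_le hW hl (avg_centered hN x) hb0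
      have h2 : dualDev f α τ x (fun i => x i - mix W x i) =
          fun i => ((x i - avg x) - mix W (fun j => x j - avg x) i) + b i := by
        funext i
        rw [dualDev, mix_sub, mix_const hW, sub_sub_sub_cancel_right]
      rw [h2]
      exact h1
    · have h1 := dualEnergy_le hW hl hb0
      have h2 : dualDev f α τ x 0 = b := by
        funext i
        simp [dualDev, hb]
      rw [h2]
      have h3 : 0 ≤ (∑ i, ‖b i‖ ^ 2) / (1 - mixingRate W) := by positivity
      linarith
  have hE : energy hW.posDef.isHermitian f α τ x y / N ≤
      3 * (α ^ 2 * τ ^ 2 * heterogeneity f (avg x) / (1 - mixingRate W)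
          + consensusError x / (minEigenvalue W * N)) := by
    rw [hbsum] at hdual
    have hhet : 0 ≤ heterogeneity f (avg x) :=
      mul_nonneg (by positivity) (Finset.sum_nonneg fun _ _ => sq_nonneg _)
    have h1 : energy hW.posDef.isHermitian f α τ x y ≤ 3 * (consensusError x / minEigenvalue W)
        + 3 * (N * (α ^ 2 * τ ^ 2 * heterogeneity f (avg x)) / (1 - mixingRate W)) := by
      have h3 : 0 ≤ N * (α ^ 2 * τ ^ 2 * heterogeneity f (avg x)) / (1 - mixingRate W) := by
        positivity
      rw [energy]
      linarith
    refine (div_le_div_of_nonneg_right h1 hN'.le).trans (le_of_eq ?_)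
    field_simp
    ring
  have h4 := mul_le_mul_of_nonneg_left hE
    (by positivity : 0 ≤ 160 * (α * τ * L / (1 - mixingRate W)))
  rw [lyapunov]
  linarith

end Lyapunov

/-! ### Orthogonality of noise in `L²` -/

section Noise

variable {Ω Ξ E : Type*} [NormedAddCommGroup E]

section L2

variable {mΩ : MeasurableSpace Ω} {P : Measure Ω}

lemma integrable_norm_sq_of_memLp {X : Ω → E} (hX : MemLp X 2 P) :
    Integrable (fun ω => ‖X ω‖ ^ 2) P :=
  hX.norm.integrable_sq

variable [InnerProductSpace ℝ E]

lemma integrable_inner_of_memLp {X Y : Ω → E} (hX : MemLp X 2 P)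
    (hY : MemLp Y 2 P) : Integrable (fun ω => inner ℝ (X ω) (Y ω)) P := by
  refine ((hX.norm.integrable_mul hY.norm)).mono (hX.1.inner hY.1) (Filter.Eventually.of_forall ?_)
  intro ω
  rw [Pi.mul_apply, norm_mul, norm_norm, norm_norm]
  exact norm_inner_le_norm _ _

/-- Pythagoras: orthogonality yields the factor `card` where Cauchy–Schwarz alone would give its
square. -/
lemma integral_norm_sum_sq_le {ι : Type*} (A : Finset ι) {n : ι → Ω → E} {s : ℝ}
    (hn : ∀ a ∈ A, MemLp (n a) 2 P)
    (horth : ∀ a ∈ A, ∀ b ∈ A, a ≠ b → ∫ ω, inner ℝ (n a ω) (n b ω) ∂P = 0)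
    (hs : ∀ a ∈ A, ∫ ω, ‖n a ω‖ ^ 2 ∂P ≤ s) :
    ∫ ω, ‖∑ a ∈ A, n a ω‖ ^ 2 ∂P ≤ A.card * s := by
  classical
  induction A using Finset.induction_on with
  | empty => simp
  | insert a A ha ih =>
    have ih' := ih (fun b hb => hn b (Finset.mem_insert_of_mem hb))
      (fun b hb c hc => horth b (Finset.mem_insert_of_mem hb) c (Finset.mem_insert_of_mem hc))
      (fun b hb => hs b (Finset.mem_insert_of_mem hb))
    have hna := hn a (Finset.mem_insert_self a A)
    have hsum : MemLp (fun ω => ∑ b ∈ A, n b ω) 2 P :=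
      memLp_finsetSum A fun b hb => hn b (Finset.mem_insert_of_mem hb)
    have hcross : ∫ ω, inner ℝ (n a ω) (∑ b ∈ A, n b ω) ∂P = 0 := by
      simp only [inner_sum]
      rw [integral_finsetSum A fun b hb =>
        integrable_inner_of_memLp hna (hn b (Finset.mem_insert_of_mem hb))]
      refine Finset.sum_eq_zero fun b hb => ?_
      exact horth a (Finset.mem_insert_self a A) b (Finset.mem_insert_of_mem hb)
        (fun h => ha (h ▸ hb))
    have e : ∀ ω, ‖∑ b ∈ insert a A, n b ω‖ ^ 2 = ‖n a ω‖ ^ 2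
        + 2 * inner ℝ (n a ω) (∑ b ∈ A, n b ω) + ‖∑ b ∈ A, n b ω‖ ^ 2 := by
      intro ω
      rw [Finset.sum_insert ha, norm_add_sq_real]
    simp only [e]
    have hint : Integrable (fun ω => ‖n a ω‖ ^ 2 + 2 * inner ℝ (n a ω) (∑ b ∈ A, n b ω)) P :=
      (integrable_norm_sq_of_memLp hna).add ((integrable_inner_of_memLp hna hsum).const_mul 2)
    rw [integral_add hint (integrable_norm_sq_of_memLp hsum),
      integral_add (integrable_norm_sq_of_memLp hna)
      ((integrable_inner_of_memLp hna hsum).const_mul 2), integral_const_mul, hcross,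
      Finset.card_insert_of_notMem ha]
    have := hs a (Finset.mem_insert_self a A)
    push_cast
    linarith

end L2

variable [InnerProductSpace ℝ E] [MeasurableSpace E] [BorelSpace E]
  [SecondCountableTopology E] [CompleteSpace E]

/-- A function of `X` and of an independent sample `ξ` that has conditional mean zero given some
`σ`-algebra containing the information in `X` is orthogonal to every square integrable variable
that is independent of the sample. -/
lemma integral_inner_eq_zero_of_indep {𝒢 ℋ : MeasurableSpace Ω} {mΩ : MeasurableSpace Ω}
    [mΞ : MeasurableSpace Ξ] {P : Measure Ω} [IsProbabilityMeasure P] (hℋ : ℋ ≤ mΩ) (h𝒢 : 𝒢 ≤ mΩ)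
    {X Y : Ω → E} {ξ : Ω → Ξ} (hX : Measurable[𝒢] X) (hXℋ : Measurable[ℋ] X)
    (hY : Measurable[𝒢] Y) (hξ : Measurable ξ)
    (hind : Indep 𝒢 (MeasurableSpace.comap ξ mΞ) P)
    {k : E × Ξ → E} (hk : Measurable k) (hkL : MemLp (fun ω => k (X ω, ξ ω)) 2 P)
    (hk0 : P[fun ω => k (X ω, ξ ω) | ℋ] =ᵐ[P] 0) (hYL : MemLp Y 2 P) :
    ∫ ω, inner ℝ (Y ω) (k (X ω, ξ ω)) ∂P = 0 := by
  have hXm : Measurable X := hX.mono h𝒢 le_rfl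
  have hYm : Measurable Y := hY.mono h𝒢 le_rfl
  have hYX : Measurable[𝒢] fun ω => (Y ω, X ω) := hY.prodMk hX
  have hind1 : IndepFun X ξ P := indep_of_indep_of_le_left hind hX.comap_le
  have hind2 : IndepFun (fun ω => (Y ω, X ω)) ξ P := indep_of_indep_of_le_left hind hYX.comap_le
  have hlaw1 := hind1.map_prod_eq_prod_map_map hXm.aemeasurable hξ.aemeasurable
  have hlaw2 := hind2.map_prod_eq_prod_map_map (hYm.prodMk hXm).aemeasurable hξ.aemeasurable
  have : IsProbabilityMeasure (P.map ξ) := Measure.isProbabilityMeasure_map hξ.aemeasurable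
  have : IsProbabilityMeasure (P.map X) := Measure.isProbabilityMeasure_map hXm.aemeasurable
  have : IsProbabilityMeasure (P.map fun ω => (Y ω, X ω)) :=
    Measure.isProbabilityMeasure_map (hYm.prodMk hXm).aemeasurable
  have hkint : Integrable (fun ω => k (X ω, ξ ω)) P := hkL.integrable one_le_two
  have hkint' : Integrable k ((P.map X).prod (P.map ξ)) := by
    rw [← hlaw1, integrable_map_measure hk.aestronglyMeasurable (hXm.prodMk hξ).aemeasurable]
    exact hkint
  -- The kernel averaged over the sample integrates to zero over every event `X ∈ A`, because such
  -- events lie in `ℋ`; hence it vanishes for almost every value of `X`.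
  have hK : (fun p => ∫ s, k (p, s) ∂(P.map ξ)) =ᵐ[P.map X] 0 := by
    refine hkint'.integral_prod_left.ae_eq_zero_of_forall_setIntegral_eq_zero fun A hA _ => ?_
    have h1 : ∫ ω in X ⁻¹' A, k (X ω, ξ ω) ∂P = 0 := by
      rw [← setIntegral_condExp hℋ hkint (hXℋ hA), setIntegral_congr_ae (g := fun _ => 0)
        (hℋ _ (hXℋ hA)) (hk0.mono fun ω h _ => h)]
      simp
    have h2 : ∫ ω in X ⁻¹' A, k (X ω, ξ ω) ∂P =
        ∫ z in A ×ˢ Set.univ, k z ∂((P.map X).prod (P.map ξ)) := by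
      rw [← hlaw1, setIntegral_map (hA.prod MeasurableSet.univ) hk.aestronglyMeasurable
        (hXm.prodMk hξ).aemeasurable]
      congr 2
      ext ω
      simp
    rw [h1, setIntegral_prod _ hkint'.integrableOn] at h2
    simpa using h2.symm
  have hmeas : Measurable fun z : (E × E) × Ξ => inner ℝ z.1.1 (k (z.1.2, z.2)) :=
    measurable_fst.fst.inner (hk.comp (measurable_fst.snd.prodMk measurable_snd))
  have hint := integrable_inner_of_memLp hYL hkL
  have hint' : Integrable (fun z : (E × E) × Ξ => inner ℝ z.1.1 (k (z.1.2, z.2)))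
      ((P.map fun ω => (Y ω, X ω)).prod (P.map ξ)) := by
    rw [← hlaw2, integrable_map_measure hmeas.aestronglyMeasurable
      ((hYm.prodMk hXm).prodMk hξ).aemeasurable]
    exact hint
  have h3 : ∫ ω, inner ℝ (Y ω) (k (X ω, ξ ω)) ∂P = ∫ z : (E × E) × Ξ,
      inner ℝ z.1.1 (k (z.1.2, z.2)) ∂((P.map fun ω => (Y ω, X ω)).prod (P.map ξ)) := by
    rw [← hlaw2, integral_map ((hYm.prodMk hXm).prodMk hξ).aemeasurable
      hmeas.aestronglyMeasurable]
  -- By Fubini the sample is integrated first, with `Y` and `X` frozen, and the inner integral is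
  -- `Y` paired with the vanishing averaged kernel. This needs no relation between `Y` and `ℋ`.
  rw [h3, integral_prod _ hint', integral_map (hYm.prodMk hXm).aemeasurable
    hint'.integral_prod_left.aestronglyMeasurable]
  refine integral_eq_zero_of_ae ?_
  filter_upwards [ae_of_ae_map hXm.aemeasurable hK,
    ae_of_ae_map hXm.aemeasurable hkint'.prod_right_ae] with ω h4 h5
  simp only [Pi.zero_apply] at h4 ⊢
  rw [integral_inner h5, h4, inner_zero_right]

end Noise

/-! ### Measurable dependence of the iterates on the samples -/

section Measurability

variable {N m : ℕ} {Ξ : Type v} [MeasurableSpace Ξ] {Ω : Type u} {W : Matrix (Fin N) (Fin N) ℝ}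
  {F : Fin N → Vec m → Ξ → ℝ} {α β : ℝ} {τ : ℕ} {ξ : ℕ → ℕ → Fin N → Ω → Ξ} {x0 y0 : Fin N → Vec m}

lemma measurable_localIter {_ : MeasurableSpace Ω}
    (hF : ∀ i, Measurable fun p : Vec m × Ξ => stochGrad F i p.1 p.2)
    {s : ℕ → Fin N → Ω → Ξ} {x y : Ω → Fin N → Vec m} (hx : ∀ i, Measurable fun ω => x ω i)
    (hy : ∀ i, Measurable fun ω => y ω i) (t : ℕ) (hs : ∀ k < t, ∀ j, Measurable (s k j))
    (i : Fin N) :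
    Measurable fun ω => localIter F α β (fun k j => s k j ω) (x ω) (y ω) t i := by
  induction t generalizing i with
  | zero => exact hx i
  | succ t ih =>
    have h := fun i => ih (fun k hk => hs k (hk.trans t.lt_succ_self)) i
    simp only [localIter]
    exact ((h i).sub (((hF i).comp ((h i).prodMk (hs t t.lt_succ_self i))).const_smul α)).sub
      ((hy i).const_smul β)

lemma measurable_mix {_ : MeasurableSpace Ω} {x : Ω → Fin N → Vec m}
    (hx : ∀ i, Measurable fun ω => x ω i) (i : Fin N) : Measurable fun ω => mix W (x ω) i :=
  Finset.measurable_fun_sum _ fun j _ => (hx j).const_smul (W i j)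

lemma measurable_iter {_ : MeasurableSpace Ω}
    (hF : ∀ i, Measurable fun p : Vec m × Ξ => stochGrad F i p.1 p.2) (r : ℕ)
    (hξ : ∀ q k j, q < r → k < τ → Measurable (ξ q k j)) :
    (∀ i, Measurable fun ω => (iter W F α β τ (fun r t i => ξ r t i ω) x0 y0 r).1 i) ∧
      ∀ i, Measurable fun ω => (iter W F α β τ (fun r t i => ξ r t i ω) x0 y0 r).2 i := by
  induction r with
  | zero => exact ⟨fun i => measurable_const, fun i => measurable_const⟩
  | succ r ih =>
    have h := ih fun q k j hq => hξ q k j (hq.trans r.lt_succ_self)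
    have hφ := measurable_localIter (α := α) (β := β) hF h.1 h.2 τ
      (fun k hk j => hξ r k j r.lt_succ_self hk)
    simp only [iter]
    exact ⟨measurable_mix hφ, fun i => ((h.2 i).add (hφ i)).sub (measurable_mix hφ i)⟩

lemma measurable_phi {_ : MeasurableSpace Ω}
    (hF : ∀ i, Measurable fun p : Vec m × Ξ => stochGrad F i p.1 p.2) (r t : ℕ)
    (hξ : ∀ q k j, (q < r ∧ k < τ) ∨ (q = r ∧ k < t) → Measurable (ξ q k j)) (i : Fin N) :
    Measurable fun ω => phi W F α β τ (fun r t i => ξ r t i ω) x0 y0 r t i := by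
  have h := measurable_iter (W := W) (α := α) (β := β) (x0 := x0) (y0 := y0) hF r
    fun q k j hq hk => hξ q k j (Or.inl ⟨hq, hk⟩)
  exact measurable_localIter hF h.1 h.2 t (fun k hk j => hξ r k j (Or.inr ⟨rfl, hk⟩)) i

end Measurability

/-! ### Random trajectories and moments of the gradient errors -/

section Trajectories

variable {N m : ℕ} {Ξ : Type v} {Ω : Type u}

/-- The random local iterates of Local Exact-Diffusion with `β = 1 / τ`. -/
noncomputable def randPhi (W : Matrix (Fin N) (Fin N) ℝ) (F : Fin N → Vec m → Ξ → ℝ) (α : ℝ)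
    (τ : ℕ) (ξ : ℕ → ℕ → Fin N → Ω → Ξ) (x0 y0 : Fin N → Vec m) (r t : ℕ) (i : Fin N) (ω : Ω) :
    Vec m :=
  phi W F α (1 / (τ : ℝ)) τ (fun r t i => ξ r t i ω) x0 y0 r t i

/-- The random state `(xʳ, yʳ)` of Local Exact-Diffusion with `β = 1 / τ`. -/
noncomputable def randIter (W : Matrix (Fin N) (Fin N) ℝ) (F : Fin N → Vec m → Ξ → ℝ) (α : ℝ)
    (τ : ℕ) (ξ : ℕ → ℕ → Fin N → Ω → Ξ) (x0 y0 : Fin N → Vec m) (r : ℕ) (ω : Ω) :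
    (Fin N → Vec m) × (Fin N → Vec m) :=
  iter W F α (1 / (τ : ℝ)) τ (fun r t i => ξ r t i ω) x0 y0 r

/-- The errors of the stochastic gradients along Local Exact-Diffusion. -/
noncomputable def gradError (f : Fin N → Vec m → ℝ) (W : Matrix (Fin N) (Fin N) ℝ)
    (F : Fin N → Vec m → Ξ → ℝ) (α : ℝ) (τ : ℕ) (ξ : ℕ → ℕ → Fin N → Ω → Ξ)
    (x0 y0 : Fin N → Vec m) (r t : ℕ) (i : Fin N) (ω : Ω) : Vec m :=
  stochGrad F i (randPhi W F α τ ξ x0 y0 r t i ω) (ξ r t i ω)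
    - gradient (f i) (randPhi W F α τ ξ x0 y0 r t i ω)

variable {W : Matrix (Fin N) (Fin N) ℝ} {F : Fin N → Vec m → Ξ → ℝ} {L μ α σ : ℝ} {τ : ℕ}
  {ξ : ℕ → ℕ → Fin N → Ω → Ξ} {x0 y0 : Fin N → Vec m} {f : Fin N → Vec m → ℝ} {xs : Vec m}

/-- The noise is defined as the actual gradient error, so every deterministic estimate for a round
applies for each `ω`. -/
lemma isRound_randPhi (r : ℕ) (ω : Ω) :
    IsRound f α τ (randIter W F α τ ξ x0 y0 r ω).1 (randIter W F α τ ξ x0 y0 r ω).2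
      (fun t i => randPhi W F α τ ξ x0 y0 r t i ω)
      (fun t i => gradError f W F α τ ξ x0 y0 r t i ω) where
  zero := rfl
  succ t i := by
    simp only [gradError, add_sub_cancel]
    rfl

lemma randIter_succ (r : ℕ) (ω : Ω) :
    randIter W F α τ ξ x0 y0 (r + 1) ω = (mix W fun i => randPhi W F α τ ξ x0 y0 r τ i ω, fun i =>
      (randIter W F α τ ξ x0 y0 r ω).2 i + randPhi W F α τ ξ x0 y0 r τ i ω
        - mix W (fun i => randPhi W F α τ ξ x0 y0 r τ i ω) i) :=
  rfl

lemma avg_randIter_snd (hW : IsWeightMatrix W) (hy : avg y0 = 0) (r : ℕ) (ω : Ω) :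
    avg (randIter W F α τ ξ x0 y0 r ω).2 = 0 := by
  induction r with
  | zero => exact hy
  | succ r ih =>
    rw [randIter_succ]
    rw [avg_sub _ (mix W _), avg_add, avg_mix hW, ih, zero_add, sub_self]

variable [MeasurableSpace Ξ]

/-- The information in all samples except the one drawn by node `i` at step `t` of round `r`. -/
@[reducible]
def otherSamples (τ : ℕ) (ξ : ℕ → ℕ → Fin N → Ω → Ξ) (p : ℕ × Fin τ × Fin N) :
    MeasurableSpace Ω :=
  ⨆ q ∈ ({p}ᶜ : Set (ℕ × Fin τ × Fin N)),
    MeasurableSpace.comap (fun ω => ξ q.1 (q.2.1 : ℕ) q.2.2 ω) inferInstance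

lemma measurable_otherSamples {p : ℕ × Fin τ × Fin N} {q k : ℕ} {j : Fin N} (hk : k < τ)
    (h : q ≠ p.1 ∨ k ≠ p.2.1 ∨ j ≠ p.2.2) : Measurable[otherSamples τ ξ p] (ξ q k j) := by
  have hne : (q, (⟨k, hk⟩ : Fin τ), j) ∈ ({p}ᶜ : Set (ℕ × Fin τ × Fin N)) := by
    rintro rfl
    simp at h
  exact Measurable.of_comap_le (le_iSup₂ (f := fun (q : ℕ × Fin τ × Fin N)
    (_ : q ∈ ({p}ᶜ : Set (ℕ × Fin τ × Fin N))) =>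
      MeasurableSpace.comap (fun ω => ξ q.1 (q.2.1 : ℕ) q.2.2 ω) inferInstance) _ hne)

lemma measurable_randPhi_otherSamples
    (hF : ∀ i, Measurable fun p : Vec m × Ξ => stochGrad F i p.1 p.2)
    (p : ℕ × Fin τ × Fin N) {t : ℕ} (ht : t ≤ p.2.1) (i : Fin N) :
    Measurable[otherSamples τ ξ p] (randPhi W F α τ ξ x0 y0 p.1 t i) := by
  refine measurable_phi hF p.1 t (fun q k j h => ?_) i
  rcases h with ⟨hq, hk⟩ | ⟨hq, hk⟩
  · exact measurable_otherSamples hk (Or.inl hq.ne)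
  · have := p.2.1.2
    exact measurable_otherSamples (by omega) (Or.inr (Or.inl (by omega)))

lemma measurable_randIter_otherSamples
    (hF : ∀ i, Measurable fun p : Vec m × Ξ => stochGrad F i p.1 p.2)
    (p : ℕ × Fin τ × Fin N) (i : Fin N) :
    Measurable[otherSamples τ ξ p] fun ω => (randIter W F α τ ξ x0 y0 p.1 ω).1 i :=
  -- The state at the start of a round is its local iterate at step `0`.
  measurable_randPhi_otherSamples hF p (Nat.zero_le _) i

lemma measurable_gradError_otherSamples
    (hF : ∀ i, Measurable fun p : Vec m × Ξ => stochGrad F i p.1 p.2)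
    (hf : ∀ i, IsLSmooth L (f i))
    (p : ℕ × Fin τ × Fin N) {t : ℕ} (ht : t ≤ p.2.1) (i : Fin N) (hne : t ≠ p.2.1 ∨ i ≠ p.2.2) :
    Measurable[otherSamples τ ξ p] (gradError f W F α τ ξ x0 y0 p.1 t i) := by
  have h := measurable_randPhi_otherSamples (W := W) (α := α) (x0 := x0) (y0 := y0) (ξ := ξ)
    hF p ht i
  have hk : t < τ := lt_of_le_of_lt ht p.2.1.2
  exact ((hF i).comp (h.prodMk (measurable_otherSamples hk (Or.inr hne)))).sub
    ((hf i).continuous_gradient.measurable.comp h)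

variable {mΩ : MeasurableSpace Ω} {P : Measure Ω}

lemma memLp_avg {X : Ω → Fin N → Vec m} (hX : ∀ i, MemLp (fun ω => X ω i) 2 P) :
    MemLp (fun ω => avg (X ω)) 2 P :=
  (memLp_finsetSum Finset.univ fun i _ => hX i).const_smul (N : ℝ)⁻¹

lemma memLp_mix {X : Ω → Fin N → Vec m} (hX : ∀ i, MemLp (fun ω => X ω i) 2 P) (i : Fin N) :
    MemLp (fun ω => mix W (X ω) i) 2 P :=
  memLp_finsetSum Finset.univ fun j _ => (hX j).const_smul (W i j)

lemma memLp_gradError (hB : BoundedNoise P f F σ τ ξ (randPhi W F α τ ξ x0 y0))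
    (r : ℕ) {t : ℕ} (ht : t < τ) (i : Fin N) : MemLp (gradError f W F α τ ξ x0 y0 r t i) 2 P :=
  hB.memLp r t i ht

lemma memLp_noiseSum (hB : BoundedNoise P f F σ τ ξ (randPhi W F α τ ξ x0 y0)) (r : ℕ)
    {t : ℕ} (ht : t ≤ τ) (i : Fin N) :
    MemLp (fun ω => noiseSum t (fun s i => gradError f W F α τ ξ x0 y0 r s i ω) i) 2 P :=
  memLp_finsetSum _ fun _ hs => memLp_gradError hB r ((Finset.mem_range.1 hs).trans_le ht) i

lemma integrable_noiseDrift (hB : BoundedNoise P f F σ τ ξ (randPhi W F α τ ξ x0 y0)) (r : ℕ) :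
    Integrable (fun ω => noiseDrift τ fun t i => gradError f W F α τ ξ x0 y0 r t i ω) P :=
  integrable_finsetSum _ fun _ ht => integrable_finsetSum _ fun i _ =>
    integrable_norm_sq_of_memLp (memLp_noiseSum hB r (Finset.mem_range.1 ht).le i)

variable [IsProbabilityMeasure P]

lemma measurable_randPhi (hF : ∀ i, Measurable fun p : Vec m × Ξ => stochGrad F i p.1 p.2)
    (hξ : ∀ r t i, Measurable (ξ r t i)) (r t : ℕ) (i : Fin N) :
    Measurable (randPhi W F α τ ξ x0 y0 r t i) :=
  measurable_phi hF r t (fun q k j _ => hξ q k j) i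

lemma memLp_gradient {g : Vec m → ℝ} (hg : IsLSmooth L g) {X : Ω → Vec m} (hX : MemLp X 2 P) :
    MemLp (fun ω => gradient g (X ω)) 2 P := by
  have hlip : LipschitzWith L.toNNReal (fun x => gradient g x - gradient g 0) := by
    refine LipschitzWith.of_dist_le_mul fun x y => ?_
    rw [dist_eq_norm, dist_eq_norm, sub_sub_sub_cancel_right]
    exact (hg.gradient_lipschitz x y).trans
      (mul_le_mul_of_nonneg_right (Real.le_coe_toNNReal L) (norm_nonneg _))
  have h := (hlip.comp_memLp (sub_self _) hX).add (memLp_const (gradient g 0))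
  refine h.ae_eq (Filter.Eventually.of_forall fun ω => ?_)
  simp

lemma memLp_randPhi_of_memLp_randIter (hf : ∀ i, IsLSmooth L (f i))
    (hB : BoundedNoise P f F σ τ ξ (randPhi W F α τ ξ x0 y0)) {r : ℕ}
    (hx : ∀ i, MemLp (fun ω => (randIter W F α τ ξ x0 y0 r ω).1 i) 2 P)
    (hy : ∀ i, MemLp (fun ω => (randIter W F α τ ξ x0 y0 r ω).2 i) 2 P)
    (t : ℕ) (ht : t ≤ τ) (i : Fin N) : MemLp (randPhi W F α τ ξ x0 y0 r t i) 2 P := by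
  induction t with
  | zero => exact hx i
  | succ t ih =>
    have h := ih (by omega)
    have hn := hB.memLp r t i (by omega)
    have h1 := (h.sub (((memLp_gradient (hf i) h).add hn).const_smul α)).sub
      ((hy i).const_smul (1 / (τ : ℝ)))
    refine h1.ae_eq (Filter.Eventually.of_forall fun ω => ?_)
    exact ((isRound_randPhi (f := f) r ω).succ t i).symm

/-- Lipschitz gradients preserve square integrability, and the gradient errors have it by
assumption, so it propagates from the deterministic start. -/
lemma memLp_randIter (hf : ∀ i, IsLSmooth L (f i))
    (hB : BoundedNoise P f F σ τ ξ (randPhi W F α τ ξ x0 y0)) (r : ℕ) :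
    (∀ i, MemLp (fun ω => (randIter W F α τ ξ x0 y0 r ω).1 i) 2 P) ∧
      ∀ i, MemLp (fun ω => (randIter W F α τ ξ x0 y0 r ω).2 i) 2 P := by
  induction r with
  | zero => exact ⟨fun i => memLp_const _, fun i => memLp_const _⟩
  | succ r ih =>
    have hφ := memLp_randPhi_of_memLp_randIter hf hB ih.1 ih.2 τ le_rfl
    simp only [randIter_succ]
    exact ⟨memLp_mix hφ, fun i => ((ih.2 i).add (hφ i)).sub (memLp_mix hφ i)⟩

lemma history_le (hF : ∀ i, Measurable fun p : Vec m × Ξ => stochGrad F i p.1 p.2)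
    (hξ : ∀ r t i, Measurable (ξ r t i)) (r t : ℕ) :
    history τ (randPhi W F α τ ξ x0 y0) r t ≤ mΩ :=
  iSup_le fun q => iSup_le fun k => iSup_le fun j => iSup_le fun _ =>
    (measurable_randPhi hF hξ q k j).comap_le

lemma integral_norm_gradError_sq_le
    (hF : ∀ i, Measurable fun p : Vec m × Ξ => stochGrad F i p.1 p.2)
    (hB : BoundedNoise P f F σ τ ξ (randPhi W F α τ ξ x0 y0)) (r : ℕ) {t : ℕ} (ht : t < τ)
    (i : Fin N) : ∫ ω, ‖gradError f W F α τ ξ x0 y0 r t i ω‖ ^ 2 ∂P ≤ σ ^ 2 := by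
  have h := integral_mono_ae integrable_condExp (integrable_const _) (hB.variance_le r t i ht)
  rw [integral_condExp (history_le hF hB.measurable_sample r t)] at h
  exact h.trans (by simp)

lemma integral_inner_gradError_eq_zero
    (hF : ∀ i, Measurable fun p : Vec m × Ξ => stochGrad F i p.1 p.2)
    (hf : ∀ i, IsLSmooth L (f i))
    (hB : BoundedNoise P f F σ τ ξ (randPhi W F α τ ξ x0 y0)) (p : ℕ × Fin τ × Fin N)
    {Y : Ω → Vec m} (hY : Measurable[otherSamples τ ξ p] Y) (hYL : MemLp Y 2 P) :
    ∫ ω, inner ℝ (Y ω) (gradError f W F α τ ξ x0 y0 p.1 p.2.1 p.2.2 ω) ∂P = 0 := by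
  have hle : ∀ q : ℕ × Fin τ × Fin N,
      MeasurableSpace.comap (fun ω => ξ q.1 (q.2.1 : ℕ) q.2.2 ω) inferInstance ≤ mΩ :=
    fun q => (hB.measurable_sample _ _ _).comap_le
  -- Joint independence separates sample `p` from the σ-algebra of all the others, including those
  -- of other nodes at the same step.
  have hind := indep_iSup_of_disjoint hle hB.independent.iIndep
    (S := {p}ᶜ) (T := {p}) disjoint_compl_left
  rw [iSup_singleton] at hind
  refine integral_inner_eq_zero_of_indep (history_le hF hB.measurable_sample p.1 p.2.1)
    (iSup₂_le fun q _ => hle q)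
    (measurable_randPhi_otherSamples hF p le_rfl p.2.2) ?_ hY (hB.measurable_sample p.1 p.2.1 p.2.2)
    hind (k := fun z => stochGrad F p.2.2 z.1 z.2 - gradient (f p.2.2) z.1)
    ((hF _).sub ((hf _).continuous_gradient.measurable.comp measurable_fst))
    (hB.memLp p.1 p.2.1 p.2.2 p.2.1.2) (hB.unbiased p.1 p.2.1 p.2.2 p.2.1.2) hYL
  refine Measurable.of_comap_le ?_
  exact le_iSup_of_le p.1 (le_iSup_of_le (p.2.1 : ℕ) (le_iSup_of_le p.2.2
    (le_iSup_of_le (Or.inr ⟨rfl, le_rfl⟩) le_rfl)))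

/-- The earlier error is a function of samples other than the one behind the later error. For two
nodes at the same step this still holds, although the history at that step need not determine either
error. -/
lemma integral_inner_gradError_gradError_eq_zero
    (hF : ∀ i, Measurable fun p : Vec m × Ξ => stochGrad F i p.1 p.2)
    (hf : ∀ i, IsLSmooth L (f i))
    (hB : BoundedNoise P f F σ τ ξ (randPhi W F α τ ξ x0 y0)) (r : ℕ) {t s : ℕ} (ht : t < τ)
    (hs : s < τ) (i j : Fin N) (hne : t ≠ s ∨ i ≠ j) :
    ∫ ω, inner ℝ (gradError f W F α τ ξ x0 y0 r t i ω)
      (gradError f W F α τ ξ x0 y0 r s j ω) ∂P = 0 := by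
  rcases le_total t s with h | h
  · exact integral_inner_gradError_eq_zero hF hf hB (r, ⟨s, hs⟩, j)
      (measurable_gradError_otherSamples hF hf (r, ⟨s, hs⟩, j) h i hne)
      (memLp_gradError hB r ht i)
  · refine (integral_congr_ae (Filter.Eventually.of_forall fun ω =>
      real_inner_comm _ _)).trans ?_
    exact integral_inner_gradError_eq_zero hF hf hB (r, ⟨t, ht⟩, i)
      (measurable_gradError_otherSamples hF hf (r, ⟨t, ht⟩, i) h j
        (hne.imp Ne.symm Ne.symm)) (memLp_gradError hB r hs j)

lemma integral_norm_sum_gradError_sq_le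
    (hF : ∀ i, Measurable fun p : Vec m × Ξ => stochGrad F i p.1 p.2)
    (hf : ∀ i, IsLSmooth L (f i))
    (hB : BoundedNoise P f F σ τ ξ (randPhi W F α τ ξ x0 y0)) (r : ℕ) {t : ℕ} (ht : t ≤ τ)
    (i : Fin N) :
    ∫ ω, ‖∑ s ∈ Finset.range t, gradError f W F α τ ξ x0 y0 r s i ω‖ ^ 2 ∂P ≤ τ * σ ^ 2 := by
  have hlt : ∀ s ∈ Finset.range t, s < τ := fun s hs => (Finset.mem_range.1 hs).trans_le ht
  refine (integral_norm_sum_sq_le _ (fun s hs => memLp_gradError hB r (hlt s hs) i)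
    (fun s hs q hq hne => integral_inner_gradError_gradError_eq_zero hF hf hB r (hlt s hs)
      (hlt q hq) i i (Or.inl hne))
    (fun s hs => integral_norm_gradError_sq_le hF hB r (hlt s hs) i)).trans ?_
  rw [Finset.card_range]
  have : (t : ℝ) ≤ τ := by exact_mod_cast ht
  exact mul_le_mul_of_nonneg_right this (sq_nonneg σ)

lemma integral_sum_norm_noiseSum_sq_le
    (hF : ∀ i, Measurable fun p : Vec m × Ξ => stochGrad F i p.1 p.2)
    (hf : ∀ i, IsLSmooth L (f i))
    (hB : BoundedNoise P f F σ τ ξ (randPhi W F α τ ξ x0 y0)) (r : ℕ) :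
    ∫ ω, ∑ i, ‖noiseSum τ (fun t i => gradError f W F α τ ξ x0 y0 r t i ω) i‖ ^ 2 ∂P
      ≤ N * (τ * σ ^ 2) := by
  rw [integral_finsetSum _ fun i _ =>
    integrable_norm_sq_of_memLp (memLp_noiseSum hB r le_rfl i)]
  refine (Finset.sum_le_sum fun i _ =>
    integral_norm_sum_gradError_sq_le hF hf hB r le_rfl i).trans (le_of_eq ?_)
  simp

lemma integral_noiseDrift_le
    (hF : ∀ i, Measurable fun p : Vec m × Ξ => stochGrad F i p.1 p.2)
    (hf : ∀ i, IsLSmooth L (f i))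
    (hB : BoundedNoise P f F σ τ ξ (randPhi W F α τ ξ x0 y0)) (r : ℕ) :
    ∫ ω, noiseDrift τ (fun t i => gradError f W F α τ ξ x0 y0 r t i ω) ∂P
      ≤ τ * (N * (τ * σ ^ 2)) := by
  have hint : ∀ t ∈ Finset.range τ, ∀ i, Integrable (fun ω =>
      ‖∑ s ∈ Finset.range t, gradError f W F α τ ξ x0 y0 r s i ω‖ ^ 2) P := fun t ht i =>
    integrable_norm_sq_of_memLp (memLp_noiseSum hB r (Finset.mem_range.1 ht).le i)
  simp only [noiseDrift]
  rw [integral_finsetSum _ fun t ht => integrable_finsetSum _ fun i _ => hint t ht i]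
  have h : ∀ t ∈ Finset.range τ, ∫ ω, ∑ i,
      ‖∑ s ∈ Finset.range t, gradError f W F α τ ξ x0 y0 r s i ω‖ ^ 2 ∂P ≤ N * (τ * σ ^ 2) := by
    intro t ht
    rw [integral_finsetSum _ fun i _ => hint t ht i]
    refine (Finset.sum_le_sum fun i _ => integral_norm_sum_gradError_sq_le hF hf hB r
      (Finset.mem_range.1 ht).le i).trans (le_of_eq ?_)
    simp
  refine (Finset.sum_le_sum h).trans (le_of_eq ?_)
  simp

/-- Orthogonality is applied to all `τN` errors of the round at once; this produces the factor `1/N`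
of linear speedup. -/
lemma integral_norm_avg_noiseSum_sq_le (hN : 0 < N)
    (hF : ∀ i, Measurable fun p : Vec m × Ξ => stochGrad F i p.1 p.2)
    (hf : ∀ i, IsLSmooth L (f i))
    (hB : BoundedNoise P f F σ τ ξ (randPhi W F α τ ξ x0 y0)) (r : ℕ) :
    ∫ ω, ‖avg (noiseSum τ fun t i => gradError f W F α τ ξ x0 y0 r t i ω)‖ ^ 2 ∂P
      ≤ τ * σ ^ 2 / N := by
  have hN' : (0 : ℝ) < N := by exact_mod_cast hN
  have hlt : ∀ a ∈ Finset.range τ ×ˢ (Finset.univ : Finset (Fin N)), a.1 < τ := fun a ha =>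
    Finset.mem_range.1 (Finset.mem_product.1 ha).1
  have h := integral_norm_sum_sq_le (P := P)
    (Finset.range τ ×ˢ (Finset.univ : Finset (Fin N)))
    (n := fun a => gradError f W F α τ ξ x0 y0 r a.1 a.2)
    (fun a ha => memLp_gradError hB r (hlt a ha) a.2)
    (fun a ha b hb hne => integral_inner_gradError_gradError_eq_zero hF hf hB r (hlt a ha)
      (hlt b hb) a.2 b.2 (by
        by_contra! hc
        exact hne (Prod.ext hc.1 hc.2)))
    (fun a ha => integral_norm_gradError_sq_le hF hB r (hlt a ha) a.2)
  have e : ∀ ω, ‖avg (noiseSum τ fun t i => gradError f W F α τ ξ x0 y0 r t i ω)‖ ^ 2 =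
      ((N : ℝ)⁻¹) ^ 2 * ‖∑ a ∈ Finset.range τ ×ˢ (Finset.univ : Finset (Fin N)),
        gradError f W F α τ ξ x0 y0 r a.1 a.2 ω‖ ^ 2 := by
    intro ω
    rw [avg, norm_smul_sq, Finset.sum_product_right]
    rfl
  simp only [e]
  rw [integral_const_mul]
  refine (mul_le_mul_of_nonneg_left h (by positivity)).trans (le_of_eq ?_)
  rw [Finset.card_product, Finset.card_range, Finset.card_univ, Fintype.card_fin]
  push_cast
  field_simp

lemma memLp_noiseWeight (hN : 0 < N) (hf : ∀ i, IsLSmooth L (f i)) {X : Ω → Fin N → Vec m}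
    (hX : ∀ i, MemLp (fun ω => X ω i) 2 P) (i : Fin N) :
    MemLp (fun ω => noiseWeight W f L α τ xs (X ω) i) 2 P := by
  have h := memLp_avg hX
  exact ((((h.sub (memLp_const xs)).sub ((memLp_gradient (isLSmooth_aggregate hN hf) h).const_smul
    (α * τ))).const_smul (2 * α / N)).neg).sub
    (((hX i).sub h).const_smul (320 * (α * τ * L / (1 - mixingRate W)) *
      (1 + (1 - mixingRate W) / 4) * α / N))

lemma measurable_noiseWeight {_ : MeasurableSpace Ω} (hN : 0 < N) (hf : ∀ i, IsLSmooth L (f i))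
    {X : Ω → Fin N → Vec m} (hX : ∀ i, Measurable fun ω => X ω i) (i : Fin N) :
    Measurable fun ω => noiseWeight W f L α τ xs (X ω) i := by
  have h : Measurable fun ω => avg (X ω) :=
    (Finset.measurable_fun_sum Finset.univ fun i _ => hX i).const_smul (N : ℝ)⁻¹
  have hg := (isLSmooth_aggregate hN hf).continuous_gradient.measurable.comp h
  exact ((((h.sub measurable_const).sub (hg.const_smul (α * τ))).const_smul (2 * α / N)).neg).sub
    (((hX i).sub h).const_smul (320 * (α * τ * L / (1 - mixingRate W)) *
      (1 + (1 - mixingRate W) / 4) * α / N))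

lemma integral_sum_inner_noiseWeight_eq_zero (hN : 0 < N)
    (hF : ∀ i, Measurable fun p : Vec m × Ξ => stochGrad F i p.1 p.2)
    (hf : ∀ i, IsLSmooth L (f i))
    (hB : BoundedNoise P f F σ τ ξ (randPhi W F α τ ξ x0 y0)) (r : ℕ) :
    ∫ ω, ∑ i, inner ℝ (noiseWeight W f L α τ xs (randIter W F α τ ξ x0 y0 r ω).1 i)
      (noiseSum τ (fun t i => gradError f W F α τ ξ x0 y0 r t i ω) i) ∂P = 0 := by
  have hw := memLp_noiseWeight (W := W) (α := α) (τ := τ) (xs := xs) hN hf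
    (memLp_randIter hf hB r).1
  rw [integral_finsetSum _ fun i _ =>
    integrable_inner_of_memLp (hw i) (memLp_noiseSum hB r le_rfl i)]
  refine Finset.sum_eq_zero fun i _ => ?_
  simp only [noiseSum, inner_sum]
  rw [integral_finsetSum _ fun t ht =>
    integrable_inner_of_memLp (hw i) (memLp_gradError hB r (Finset.mem_range.1 ht) i)]
  refine Finset.sum_eq_zero fun t ht => ?_
  exact integral_inner_gradError_eq_zero hF hf hB (r, ⟨t, Finset.mem_range.1 ht⟩, i)
    (measurable_noiseWeight hN hf
      (measurable_randIter_otherSamples hF (r, ⟨t, Finset.mem_range.1 ht⟩, i)) i) (hw i)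

end Trajectories

/-! ### Lyapunov recursion in expectation -/

section Expectation

variable {N m : ℕ} {Ξ : Type v} {Ω : Type u} {W : Matrix (Fin N) (Fin N) ℝ}
  {F : Fin N → Vec m → Ξ → ℝ} {L μ α σ : ℝ} {τ : ℕ}
  {ξ : ℕ → ℕ → Fin N → Ω → Ξ} {x0 y0 : Fin N → Vec m} {f : Fin N → Vec m → ℝ} {xs : Vec m}
  [MeasurableSpace Ξ] {mΩ : MeasurableSpace Ω} {P : Measure Ω}

lemma memLp_modeCoef (hW : W.IsHermitian) {X : Ω → Fin N → Vec m}
    (hX : ∀ i, MemLp (fun ω => X ω i) 2 P) (k : Fin N) :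
    MemLp (fun ω => modeCoef hW k (X ω)) 2 P :=
  memLp_finsetSum Finset.univ fun i _ => (hX i).const_smul (hW.eigenvectorBasis k i)

variable [IsProbabilityMeasure P]

lemma integrable_norm_avg_sub_sq {X : Ω → Fin N → Vec m}
    (hX : ∀ i, MemLp (fun ω => X ω i) 2 P) (p : Vec m) :
    Integrable (fun ω => ‖avg (X ω) - p‖ ^ 2) P :=
  integrable_norm_sq_of_memLp ((memLp_avg hX).sub (memLp_const p))

lemma integrable_lyapunov (hW : W.IsHermitian) (hN : 0 < N) (hf : ∀ i, IsLSmooth L (f i))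
    {X Y : Ω → Fin N → Vec m} (hX : ∀ i, MemLp (fun ω => X ω i) 2 P)
    (hY : ∀ i, MemLp (fun ω => Y ω i) 2 P) :
    Integrable (fun ω => lyapunov hW f L α τ xs (X ω) (Y ω)) P := by
  have hx : ∀ i, MemLp (fun ω => X ω i - avg (X ω)) 2 P := fun i => (hX i).sub (memLp_avg hX)
  have hz : ∀ i, MemLp (fun ω => dualDev f α τ (X ω) (Y ω) i) 2 P := fun i =>
    (hY i).add (((memLp_gradient (hf i) (memLp_avg hX)).sub
      (memLp_gradient (isLSmooth_aggregate hN hf) (memLp_avg hX))).const_smul (α * τ))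
  refine (integrable_norm_avg_sub_sq hX xs).add (((Integrable.add ?_ ?_).div_const _).const_mul _)
  · exact integrable_finsetSum _ fun k _ =>
      (integrable_norm_sq_of_memLp (memLp_modeCoef hW hx k)).div_const _
  · exact integrable_finsetSum _ fun k _ =>
      (integrable_norm_sq_of_memLp (memLp_modeCoef hW hz k)).div_const _

/-- The gap lies between `0` and `(L/2)‖x̄ - x⋆‖²`. -/
lemma integrable_aggregate_avg_sub (hN : 0 < N) (hf : ∀ i, IsLSmooth L (f i))
    (hmin : ∀ p, aggregate f xs ≤ aggregate f p) {X : Ω → Fin N → Vec m}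
    (hX : ∀ i, MemLp (fun ω => X ω i) 2 P) :
    Integrable (fun ω => aggregate f (avg (X ω)) - aggregate f xs) P := by
  have hsm := isLSmooth_aggregate hN hf
  refine ((integrable_norm_avg_sub_sq hX xs).const_mul (L / 2)).mono'
    ((hsm.differentiable.continuous.comp_aestronglyMeasurable (memLp_avg hX).1).sub
      aestronglyMeasurable_const) (Filter.Eventually.of_forall fun ω => ?_)
  rw [Real.norm_eq_abs, abs_of_nonneg (sub_nonneg.2 (hmin _))]
  exact hsm.sub_min_le hmin _

lemma integral_lyapunov_succ_le (hW : IsWeightMatrix W) (hl : mixingRate W < 1) (hN : 0 < N)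
    (hτ : 0 < τ) (hL : 0 < L) (hα : 0 < α) (hμ : 0 ≤ μ) (hμL : μ ≤ L)
    (hf : ∀ i, IsLSmooth L (f i)) (hc : ∀ i, StrongConvexOn Set.univ μ (f i))
    (hmin : ∀ p, aggregate f xs ≤ aggregate f p) (hy : avg y0 = 0)
    (hstep : α * τ * L / (1 - mixingRate W) ≤ 1 / 100)
    (hF : ∀ i, Measurable fun p : Vec m × Ξ => stochGrad F i p.1 p.2)
    (hB : BoundedNoise P f F σ τ ξ (randPhi W F α τ ξ x0 y0)) (r : ℕ) :
    ∫ ω, lyapunov hW.posDef.isHermitian f L α τ xs (randIter W F α τ ξ x0 y0 (r + 1) ω).1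
        (randIter W F α τ ξ x0 y0 (r + 1) ω).2 ∂P ≤
      (1 - α * τ * μ / 4) * ∫ ω, lyapunov hW.posDef.isHermitian f L α τ xs
        (randIter W F α τ ξ x0 y0 r ω).1 (randIter W F α τ ξ x0 y0 r ω).2 ∂P
      - α * τ * ∫ ω, (aggregate f (avg (randIter W F α τ ξ x0 y0 r ω).1) - aggregate f xs) ∂P
      + α * τ * (2 * (α * σ ^ 2 / N) + 520 * (α ^ 2 * τ * L * σ ^ 2 / (1 - mixingRate W))) := by
  have hN' : (0 : ℝ) < N := by exact_mod_cast hN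
  have hτ' : (0 : ℝ) < τ := by exact_mod_cast hτ
  have hγ : 0 < 1 - mixingRate W := by linarith
  have hiter := memLp_randIter hf hB r
  have hiter' := memLp_randIter hf hB (r + 1)
  have iLy := integrable_lyapunov (α := α) (τ := τ) (xs := xs) hW.posDef.isHermitian hN hf
    hiter.1 hiter.2
  have iLy' := integrable_lyapunov (α := α) (τ := τ) (xs := xs) hW.posDef.isHermitian hN hf
    hiter'.1 hiter'.2
  have iGap := integrable_aggregate_avg_sub hN hf hmin hiter.1
  have hS := fun i => memLp_noiseSum hB r le_rfl i
  have iS1 := integrable_norm_sq_of_memLp (memLp_avg hS)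
  have iS2 : Integrable (fun ω => ∑ i, ‖noiseSum τ
      (fun t i => gradError f W F α τ ξ x0 y0 r t i ω) i‖ ^ 2) P :=
    integrable_finsetSum _ fun i _ => integrable_norm_sq_of_memLp (hS i)
  have iQ := integrable_noiseDrift hB r
  have hw := memLp_noiseWeight (W := W) (α := α) (τ := τ) (xs := xs) hN hf hiter.1
  have iLin : Integrable (fun ω => ∑ i, inner ℝ
      (noiseWeight W f L α τ xs (randIter W F α τ ξ x0 y0 r ω).1 i)
      (noiseSum τ (fun t i => gradError f W F α τ ξ x0 y0 r t i ω) i)) P :=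
    integrable_finsetSum _ fun i _ => integrable_inner_of_memLp (hw i) (hS i)
  set ρ := α * τ * L / (1 - mixingRate W)
  have iA := (iLy.const_mul (1 - α * τ * μ / 4)).sub (iGap.const_mul (α * τ))
  have iB := (((iS1.const_mul (α ^ 2)).const_mul 2).add
    (((iS2.const_mul (α ^ 2)).div_const N).const_mul (480 * ρ))).add
      (((iQ.const_mul (α ^ 3 * L)).div_const N).const_mul 40)
  have hmono := integral_mono iLy' ((iA.add iB).add iLin) (fun ω =>
    (isRound_randPhi r ω).lyapunov_next_le hW hl hN hτ hL hα hμ hμL hf hc hmin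
      (avg_randIter_snd hW hy r ω) hstep)
  refine hmono.trans ?_
  have e1 := integral_norm_avg_noiseSum_sq_le hN hF hf hB r
  have e2 := integral_sum_norm_noiseSum_sq_le hF hf hB r
  have e3 := integral_noiseDrift_le hF hf hB r
  have e4 := integral_sum_inner_noiseWeight_eq_zero (xs := xs) hN hF hf hB r
  rw [integral_add' (iA.add iB) iLin, integral_add' iA iB,
    integral_sub' (iLy.const_mul (1 - α * τ * μ / 4)) (iGap.const_mul (α * τ)),
    integral_add' (((iS1.const_mul (α ^ 2)).const_mul 2).add
      (((iS2.const_mul (α ^ 2)).div_const N).const_mul (480 * ρ)))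
      (((iQ.const_mul (α ^ 3 * L)).div_const N).const_mul 40),
    integral_add' ((iS1.const_mul (α ^ 2)).const_mul 2)
      (((iS2.const_mul (α ^ 2)).div_const N).const_mul (480 * ρ)), e4, add_zero]
  simp only [integral_const_mul, integral_div]
  have hρ : 0 ≤ ρ := by positivity
  refine add_le_add_right ?_ _
  have b1 := mul_le_mul_of_nonneg_left e1 (by positivity : 0 ≤ 2 * α ^ 2)
  have b2 := mul_le_mul_of_nonneg_left e2 (by positivity : 0 ≤ 480 * ρ * (α ^ 2 / N))
  have b3 := mul_le_mul_of_nonneg_left e3 (by positivity : 0 ≤ 40 * (α ^ 3 * L / N))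
  have c2 : 480 * ρ * (α ^ 2 / N) * (N * (τ * σ ^ 2)) =
      480 * (α * τ * (α ^ 2 * τ * L * σ ^ 2 / (1 - mixingRate W))) := by
    simp only [ρ]
    field_simp
  -- The noise from the drift lacks the factor `1/(1 - λ) ≥ 1`; inserting it lets `40` join `480` to
  -- make `520`.
  have c3 : 40 * (α ^ 3 * L / N) * (τ * (N * (τ * σ ^ 2))) ≤
      40 * (α * τ * (α ^ 2 * τ * L * σ ^ 2 / (1 - mixingRate W))) := by
    have d1 : α ^ 2 * τ * L * σ ^ 2 ≤ α ^ 2 * τ * L * σ ^ 2 / (1 - mixingRate W) := by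
      rw [le_div_iff₀ hγ]
      exact mul_le_of_le_one_right (by positivity) (by linarith [mixingRate_nonneg (W := W)])
    have d2 := mul_le_mul_of_nonneg_left d1 (by positivity : 0 ≤ 40 * (α * τ))
    have d3 : 40 * (α ^ 3 * L / N) * (τ * (N * (τ * σ ^ 2)))
        = 40 * (α * τ) * (α ^ 2 * τ * L * σ ^ 2) := by field_simp
    rw [d3]
    linarith
  have c1 : 2 * α ^ 2 * (τ * σ ^ 2 / N) = α * τ * (2 * (α * σ ^ 2 / N)) := by ring
  calc _ = 2 * α ^ 2 * ∫ ω, ‖avg (noiseSum τ fun t i => gradError f W F α τ ξ x0 y0 r t i ω)‖ ^ 2 ∂P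
        + 480 * ρ * (α ^ 2 / N) * ∫ ω, ∑ i, ‖noiseSum τ
          (fun t i => gradError f W F α τ ξ x0 y0 r t i ω) i‖ ^ 2 ∂P
        + 40 * (α ^ 3 * L / N) *
          ∫ ω, noiseDrift τ (fun t i => gradError f W F α τ ξ x0 y0 r t i ω) ∂P := by ring
    _ ≤ _ := by linarith

lemma lyapunov_nonneg (hW : IsWeightMatrix W) (hl : mixingRate W < 1) (hN : 0 < N) (hL : 0 ≤ L)
    (hα : 0 ≤ α) (hf : ∀ i, IsLSmooth L (f i)) {x y : Fin N → Vec m} (hy : avg y = 0) :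
    ‖avg x - xs‖ ^ 2 ≤ lyapunov hW.posDef.isHermitian f L α τ xs x y := by
  have hγ : 0 < 1 - mixingRate W := by linarith
  have := energy_nonneg (τ := τ) (α := α) (x := x) hW hl hN hf hy
  exact le_add_of_nonneg_right (by positivity)

end Expectation

/-! ### Scalar recursions -/

section Recursion

lemma mul_sum_le_of_recursion {l g : ℕ → ℝ} {a B : ℝ} (hl : ∀ r, 0 ≤ l r)
    (h : ∀ r, l (r + 1) ≤ l r - a * g r + B) (R : ℕ) :
    a * ∑ r ∈ Finset.range R, g r ≤ l 0 + R * B := by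
  have key : a * ∑ r ∈ Finset.range R, g r ≤ l 0 - l R + R * B := by
    induction R with
    | zero => simp
    | succ R ih =>
      rw [Finset.sum_range_succ]
      push_cast
      linarith [h R]
  linarith [hl R]

lemma le_of_geometric_recursion {l : ℕ → ℝ} {q B : ℝ} (hq0 : 0 ≤ q) (hq1 : q < 1)
    (h : ∀ r, l (r + 1) ≤ q * l r + B) (hB : 0 ≤ B) (r : ℕ) :
    l r ≤ q ^ r * l 0 + B / (1 - q) := by
  have hq : 0 < 1 - q := by linarith
  induction r with
  | zero => simpa using div_nonneg hB hq.le
  | succ r ih =>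
    have h1 := mul_le_mul_of_nonneg_left ih hq0
    have h2 : q * (B / (1 - q)) + B = B / (1 - q) := by
      field_simp
      ring
    rw [pow_succ]
    linarith [h r]

end Recursion

end LED

/-! ### The main theorem -/

open LED in
theorem theorem2 :
    ∃ c : ℝ, 0 < c ∧ ∃ C : ℝ, 0 < C ∧
    ∀ (N m τ : ℕ), 0 < N → 0 < τ →
    ∀ (W : Matrix (Fin N) (Fin N) ℝ), IsWeightMatrix W →
    ∀ (L μ σ α : ℝ), 0 < L → 0 ≤ μ → μ ≤ L → 0 ≤ σ → 0 < α →
    ∀ (f : Fin N → Vec m → ℝ), (∀ i, IsLSmooth L (f i)) →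
      (∀ i, StrongConvexOn Set.univ μ (f i)) →
    ∀ (xstar : Vec m), (∀ x, aggregate f xstar ≤ aggregate f x) →
    ∀ (Ω : Type u) [MeasurableSpace Ω] (P : Measure Ω) [IsProbabilityMeasure P]
      (Ξ : Type v) [MeasurableSpace Ξ] (F : Fin N → Vec m → Ξ → ℝ),
      (∀ i s, Differentiable ℝ (fun x => F i x s)) →
      (∀ i, Measurable (fun p : Vec m × Ξ => stochGrad F i p.1 p.2)) →
    ∀ (ξ : ℕ → ℕ → Fin N → Ω → Ξ) (x0 y0 : Fin N → Vec m),
      ((y0 = fun i => x0 i - mix W x0 i) ∨ y0 = 0) →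
      BoundedNoise P f F σ τ ξ
        (fun r t i ω => phi W F α (1 / (τ : ℝ)) τ (fun r t i => ξ r t i ω) x0 y0 r t i) →
      (μ = 0 → α ≤ c * (1 - mixingRate W) / (τ * L) →
        (∀ r : ℕ, Integrable (fun ω => aggregate f
          (xbar W F α (1 / (τ : ℝ)) τ (fun r t i => ξ r t i ω) x0 y0 r)
            - aggregate f xstar) P) ∧
        ∀ R : ℕ, 0 < R →
          1 / (R : ℝ) * ∑ r ∈ Finset.range R,
              ∫ ω, (aggregate f (xbar W F α (1 / (τ : ℝ)) τ (fun r t i => ξ r t i ω) x0 y0 r)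
                - aggregate f xstar) ∂P
            ≤ C * (‖avg x0 - xstar‖ ^ 2 / (α * τ * R)
                + α ^ 2 * τ ^ 2 * L * heterogeneity f (avg x0) / ((1 - mixingRate W) ^ 2 * R)
                + L * consensusError x0 / ((1 - mixingRate W) * minEigenvalue W * N * R))
              + C * (α * σ ^ 2 / N + α ^ 2 * τ * L * σ ^ 2 / (1 - mixingRate W))) ∧
      (0 < μ → α ≤ c * μ * (1 - mixingRate W) / (τ * L ^ 2) →
        ∀ r : ℕ,
          Integrable (fun ω =>
            ‖xbar W F α (1 / (τ : ℝ)) τ (fun r t i => ξ r t i ω) x0 y0 r - xstar‖ ^ 2) P ∧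
          ∫ ω, ‖xbar W F α (1 / (τ : ℝ)) τ (fun r t i => ξ r t i ω) x0 y0 r - xstar‖ ^ 2 ∂P
            ≤ (1 - α * τ * μ / 4) ^ r *
                (‖avg x0 - xstar‖ ^ 2
                  + C * (α ^ 2 * τ ^ 2 * heterogeneity f (avg x0) / (1 - mixingRate W)
                    + consensusError x0 / (minEigenvalue W * N)))
              + C * (α * σ ^ 2 / (μ * N)
                  + α ^ 2 * τ * L * σ ^ 2 / (μ * (1 - mixingRate W)))) := by
  -- `1/100` is the bound on `ρ` required by the Lyapunov inequality; `3000` exceeds all constants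
  -- produced below, the largest being `2080 = 4 · 520`.
  refine ⟨1 / 100, by norm_num, 3000, by norm_num, ?_⟩
  intro N m τ hN hτ W hW L μ σ α hL hμ hμL _ hα f hf hc xs hmin Ω _ P _ Ξ _ F _ hF ξ x0 y0 hy0 hB
  have hN' : (0 : ℝ) < N := by exact_mod_cast hN
  have hτ' : (0 : ℝ) < τ := by exact_mod_cast hτ
  change BoundedNoise P f F σ τ ξ (randPhi W F α τ ξ x0 y0) at hB
  have hyavg : avg y0 = 0 := by
    rcases hy0 with rfl | rfl
    · rw [avg_sub x0 (mix W x0), avg_mix hW, sub_self]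
    · exact avg_eq_zero_of_sum (by simp)
  have hX := fun r => (memLp_randIter hf hB r).1
  have hYmem := fun r => (memLp_randIter hf hB r).2
  have hhet : 0 ≤ heterogeneity f (avg x0) :=
    mul_nonneg (by positivity) (Finset.sum_nonneg fun _ _ => sq_nonneg _)
  have hcons := consensusError_nonneg x0
  have hmpos := minEigenvalue_pos hN hW
  set γ := 1 - mixingRate W with hγdef
  set l : ℕ → ℝ := fun r => ∫ ω, lyapunov hW.posDef.isHermitian f L α τ xs
    (randIter W F α τ ξ x0 y0 r ω).1 (randIter W F α τ ξ x0 y0 r ω).2 ∂P with hldef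
  set g : ℕ → ℝ := fun r =>
    ∫ ω, (aggregate f (avg (randIter W F α τ ξ x0 y0 r ω).1) - aggregate f xs) ∂P
  have hl0 : l 0 = lyapunov hW.posDef.isHermitian f L α τ xs x0 y0 := by
    simp only [hldef, randIter, iter, integral_const, probReal_univ, one_smul]
  have hg0 : ∀ r, 0 ≤ g r := fun r => integral_nonneg fun ω => sub_nonneg.2 (hmin _)
  constructor
  · rintro rfl hstep
    -- As `α > 0`, the stepsize bound itself forces `λ < 1`.
    have hγ : 0 < γ := by
      by_contra! hneg
      have : 1 / 100 * γ / (τ * L) ≤ 0 :=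
        div_nonpos_of_nonpos_of_nonneg (by linarith) (by positivity)
      linarith
    have hl : mixingRate W < 1 := by linarith
    have hstep' : α * τ * L / γ ≤ 1 / 100 := by
      rw [le_div_iff₀ (by positivity)] at hstep
      rw [div_le_iff₀ hγ]
      linarith
    refine ⟨fun r => integrable_aggregate_avg_sub hN hf hmin (hX r), fun R hR => ?_⟩
    have hR' : (0 : ℝ) < R := by exact_mod_cast hR
    have hrec := fun r => integral_lyapunov_succ_le hW hl hN hτ hL hα hμ hμL hf hc hmin hyavg
      hstep' hF hB r
    have hsum := mul_sum_le_of_recursion (l := l) (g := g) (a := α * τ)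
      (fun r => integral_nonneg fun ω => (sq_nonneg _).trans
        (lyapunov_nonneg hW hl hN hL.le hα.le hf (avg_randIter_snd hW hyavg r ω)))
      (fun r => by simpa using hrec r) R
    have hzero := lyapunov_zero_le (xs := xs) (τ := τ) hW hl hN hL.le hα.le hf hy0
    rw [← hl0, ← hγdef] at hzero
    change 1 / (R : ℝ) * ∑ r ∈ Finset.range R, g r ≤ _
    have h1 : 1 / (R : ℝ) * ∑ r ∈ Finset.range R, g r =
        (α * τ * ∑ r ∈ Finset.range R, g r) / (α * τ * R) := by
      field_simp
    rw [h1]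
    refine (div_le_div_of_nonneg_right (hsum.trans (add_le_add_left hzero _))
      (by positivity)).trans ?_
    set A₁ := ‖avg x0 - xs‖ ^ 2 / (α * τ * R) with hA₁
    set A₂ := α ^ 2 * τ ^ 2 * L * heterogeneity f (avg x0) / (γ ^ 2 * R) with hA₂
    set A₃ := L * consensusError x0 / (γ * minEigenvalue W * N * R) with hA₃
    set A₄ := α * σ ^ 2 / N
    set A₅ := α ^ 2 * τ * L * σ ^ 2 / γ
    have p1 : 0 ≤ A₁ := by positivity
    have p2 : 0 ≤ A₂ := by positivity
    have p3 : 0 ≤ A₃ := by positivity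
    have p4 : 0 ≤ A₄ := by positivity
    have p5 : 0 ≤ A₅ := by positivity
    calc _ = A₁ + 480 * (A₂ + A₃) + (2 * A₄ + 520 * A₅) := by
          rw [hA₁, hA₂, hA₃]
          field_simp
      _ ≤ _ := by linarith
  · intro hμ0 hstep r
    have hγ : 0 < γ := by
      by_contra! hneg
      have : 1 / 100 * μ * γ / (τ * L ^ 2) ≤ 0 := div_nonpos_of_nonpos_of_nonneg
        (mul_nonpos_of_nonneg_of_nonpos (by positivity) hneg) (by positivity)
      linarith
    have hl : mixingRate W < 1 := by linarith
    have hstep' : α * τ * L / γ ≤ 1 / 100 := by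
      rw [le_div_iff₀ (by positivity)] at hstep
      rw [div_le_iff₀ hγ]
      -- Since `μ ≤ L`, this stepsize also satisfies the bound of the convex case.
      have h1 : 1 / 100 * μ * γ ≤ 1 / 100 * γ * L := by
        have := mul_le_mul_of_nonneg_right hμL hγ.le
        linarith
      refine le_of_mul_le_mul_right ?_ hL
      linarith
    have hrec := fun r => integral_lyapunov_succ_le hW hl hN hτ hL hα hμ hμL hf hc hmin hyavg
      hstep' hF hB r
    have hγ1 : γ ≤ 1 := by linarith [mixingRate_nonneg (W := W)]
    have hθ : α * τ * μ ≤ 1 / 100 := by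
      rw [div_le_iff₀ hγ] at hstep'
      have : α * τ * μ ≤ α * τ * L := by gcongr
      linarith
    have hw : 0 < α * τ * μ := by positivity
    refine ⟨integrable_norm_avg_sub_sq (hX r) xs, ?_⟩
    have hle : ∫ ω, ‖avg (randIter W F α τ ξ x0 y0 r ω).1 - xs‖ ^ 2 ∂P ≤ l r :=
      integral_mono (integrable_norm_avg_sub_sq (hX r) xs)
        (integrable_lyapunov hW.posDef.isHermitian hN hf (hX r) (hYmem r))
        fun ω => lyapunov_nonneg hW hl hN hL.le hα.le hf (avg_randIter_snd hW hyavg r ω)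
    refine hle.trans ?_
    have hgeo := le_of_geometric_recursion (l := l) (q := 1 - α * τ * μ / 4)
      (B := α * τ * (2 * (α * σ ^ 2 / N) + 520 * (α ^ 2 * τ * L * σ ^ 2 / γ)))
      (by linarith) (by linarith) (fun r => by
        have h1 : 0 ≤ α * τ * g r := mul_nonneg (by positivity) (hg0 r)
        have h2 := hrec r
        change l (r + 1) ≤ (1 - α * τ * μ / 4) * l r - α * τ * g r + _ at h2
        linarith) (by positivity) r
    have hzero := lyapunov_zero_le (xs := xs) (τ := τ) hW hl hN hL.le hα.le hf hy0
    rw [← hl0, ← hγdef] at hzero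
    have hinit : 480 * (α * τ * L / γ) * (α ^ 2 * τ ^ 2 * heterogeneity f (avg x0) / γ
        + consensusError x0 / (minEigenvalue W * N)) ≤
        3000 * (α ^ 2 * τ ^ 2 * heterogeneity f (avg x0) / γ
        + consensusError x0 / (minEigenvalue W * N)) :=
      mul_le_mul_of_nonneg_right (by linarith) (by positivity)
    have hq : 0 ≤ 1 - α * τ * μ / 4 := by linarith
    refine hgeo.trans (add_le_add (mul_le_mul_of_nonneg_left (by linarith) (pow_nonneg hq r)) ?_)
    have p4 : 0 ≤ α * σ ^ 2 / (μ * N) := by positivity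
    have p5 : 0 ≤ α ^ 2 * τ * L * σ ^ 2 / (μ * γ) := by positivity
    -- The geometric series divides the noise per round by `1 - q = ατμ/4`, which cancels `ατ` and
    -- multiplies `2` and `520` by `4/μ`.
    calc _ = 8 * (α * σ ^ 2 / (μ * N)) + 2080 * (α ^ 2 * τ * L * σ ^ 2 / (μ * γ)) := by
          rw [sub_sub_cancel]
          field_simp
          ring
      _ ≤ _ := by linarith
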